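/- \textbf{Setting.} Let $\mathcal P$ be the free unital $*$-algebra over $\mathbb C$ on Hermitian generators $x_1,\dots,x_n$ (so $x_i^*=x_i$), let $\mathcal P_d$ be its subspace of polynomials of degree at most $d$, and let $\|p\|_2$ be the $2$-norm of the coefficient vector of $p$. Let $f$, $g_1,\dots,g_m$, $h_1,\dots,h_{m'}\in\mathcal P$ be Hermitian. The NPO problem is to minimize $\sigma(f)$ over linear functionals $\sigma:\mathcal P\to\mathbb C$ with $\sigma(1)=1$ and, for all $p,u,v\in\mathcal P$ and all $i,j$, $\sigma(pp^*)\ge0$, $\sigma(pg_ip^*)\ge 0$, $\sigma(uh_jv)=0$. A polynomial is \emph{SOS} if it is a finite sum of the form $\sum_a s_a^*s_a+\sum_{i,a}s_{ia}^*g_is_{ia}+\sum_{j,a}(u_{ja}h_jv_{ja}^*+v_{ja}h_ju_{ja}^*)$. The problem is \emph{Archimedean} if $K-\sum_i x_i^2$ is SOS for some $K>0$. $\mathcal J$ is the two-sided ideal generated by the $h_j$. For $q\in\mathcal P^{\times n}$, $\nabla p(q)$ is the part of $p(x+\epsilon q)$ linear in $\epsilon$; if $\nabla p(q)=\sum u_{a}q_{k_a}v_{a}$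 is the expansion obtained by varying one letter at a time in each word of $p$, then $\deg(\nabla p)$ is the maximum of $\deg u_a+\deg v_a$ (and $0$ if $p$ is constant). For a tuple, $\deg t=\max_k\deg t_k$. A functional $\mu$ is Hermitian if $\mu(p^*)=\overline{\mu(p)}$. A Hermitian linear $\mu:\mathcal P\to\mathbb C$ is \emph{positive} if $\mu(pp^*)\ge0$ for all $p$, and \emph{compatible} with $g\ge0$ (resp. $h=0$) if $\mu(pgp^*)\ge0$ for all $p$ (resp. $\mu(uhv)=0$ for all $u,v$). For $k\in\mathbb N$, $\varepsilon\ge0$, call a Hermitian linear functional $\mu:\mathcal P_{2k}\to\mathbb C$ a \emph{$(k,\varepsilon)$-multiplier for $g_i$} if \begin{itemize} \item $\mu(pp^*)+\varepsilon\|p\|_2^2\ge0$ whenever $\deg p\le k$; \item $\mu(pg_lp^*)+\varepsilon\|p\|_2^2\ge0$ whenever $\deg p\le k-\lceil\deg(g_l)/2\rceil$, $l=1,\dots,m$; \item $\mu(uh_jv)=0$ whenever $\deg u+\deg v\le 2k-\deg h_j$, $j=1,\dots,m'$; \item $\mu(sg_i)=\mu(g_is)=0$ whenever $\deg s\le 2k-\deg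 g_i$. \end{itemize} A \emph{$k$-multiplier for an equality constraint} is a Hermitian linear functional $\lambda:\mathcal P_{2k}\to\mathbb C$ with $\lambda(uh_lv)=0$ whenever $\deg u+\deg v\le2k-\deg h_l$, $l=1,\dots,m'$. A tuple $t\in\mathcal P^{\times n}$ is \emph{$k$-admissible} if $\deg(\nabla f),\deg(\nabla g_i),\deg(\nabla h_j)\le 2k-\deg t$ for all $i,j$. A functional $\sigma$ satisfies the \emph{essential ncKKT conditions of order $k$ with tolerances $(\varepsilon_i)_{i=1}^m$} if there are $(k,\varepsilon_i)$-multipliers $\mu_i^k$ for $g_i$ ($i=1,\dots,m$) and $k$-multipliers $\lambda_j^k$ ($j=1,\dots,m'$) with $$\sigma(\nabla f(t))-\sum_i\mu_i^k(\nabla g_i(t))-\sum_j\lambda_j^k(\nabla h_j(t))=0\quad\text{for all $k$-admissible } t.$$ \textbf{Theorem.} Let the problem be Archimedean, let $I\subset\{1,\dots,m\}$, and suppose there are $r>0$, a tuple $q\in\mathcal P^{\times n}$ of Hermitian polynomials and polynomials $s_1,\dots,s_m\in\mathcal P$ such that \begin{align*} &\nabla g_i(q)+s_ig_i+g_is_i^*-r\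 \text{ is SOS for all } i\in I,\\ &\nabla g_i(q)+s_ig_i+g_is_i^*\ \text{ is SOS for all } i\notin I,\\ &\nabla h_j(q)\in\mathcal J\ \text{ for all } j=1,\dots,m'. \end{align*} Let $\sigma^\star$ be any minimizer of the problem. Then there exist positive linear functionals $\mu_i:\mathcal P\to\mathbb C$, $i\in I$, compatible with all the constraints $g_l\ge0$ and $h_j=0$ and satisfying $\mu_i(pg_i)=\mu_i(g_ip)=0$ for all $p\in\mathcal P$, such that for all $k\in\mathbb N$ and all $\varepsilon_i>0$ ($i\notin I$) there exist $(k,\varepsilon_i)$-multipliers $\mu_i^k$ for $g_i$ ($i\notin I$) and $k$-multipliers $\lambda_j^k$ ($j=1,\dots,m'$) with $$\sum_{i\notin I}\mu_i^k(\nabla g_i(t))+\sum_j\lambda_j^k(\nabla h_j(t))=\sigma^\star(\nabla f(t))-\sum_{i\in I}\mu_i(\nabla g_i(t))\quad\text{for all $k$-admissible } t.$$ In particular, for every $k$, $\sigma^\star$ satisfies the essential ncKKT conditions of order $k$ with any tolerances such that $\varepsilon_i=0$ for $i\in I$ and $\varepsilon_i>0$ for $i\notin I$. -/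

import Mathlib

open scoped ComplexOrder

noncomputable section

/-- Non-commutative complex polynomials in `x_1, …, x_n`: finite complex linear combinations of
words in the letters `x_1, …, x_n`, multiplied by concatenation. -/
abbrev NCPoly (n : ℕ) : Type := MonoidAlgebra ℂ (FreeMonoid (Fin n))

namespace NCPoly

variable {n : ℕ}

/-- The map reversing words and conjugating coefficients, `(∑ c_w w)^* = ∑ conj(c_w) w^rev`. -/
def starAddHom (n : ℕ) : NCPoly n →+ NCPoly n where
  toFun p := p.coeff.sum fun w c => MonoidAlgebra.single (star w) (star c)
  map_zero' := by simp
  map_add' p q := by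
    rw [MonoidAlgebra.coeff_add]
    exact Finsupp.sum_add_index' (by simp) (by simp)

theorem starAddHom_single (w : FreeMonoid (Fin n)) (c : ℂ) :
    starAddHom n (MonoidAlgebra.single w c) = MonoidAlgebra.single (star w) (star c) := by
  simp [starAddHom]

theorem starAddHom_mul (p q : NCPoly n) :
    starAddHom n (p * q) = starAddHom n q * starAddHom n p := by
  induction p using MonoidAlgebra.induction_linear with
  | zero => simp
  | add p₁ p₂ h₁ h₂ => rw [add_mul, map_add, h₁, h₂, map_add, mul_add]
  | single v a =>
    induction q using MonoidAlgebra.induction_linear with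
    | zero => simp
    | add q₁ q₂ h₁ h₂ => rw [mul_add, map_add, h₁, h₂, map_add, add_mul]
    | single w b =>
      simp [starAddHom_single, MonoidAlgebra.single_mul_single, mul_comm]

theorem starAddHom_starAddHom (p : NCPoly n) : starAddHom n (starAddHom n p) = p := by
  induction p using MonoidAlgebra.induction_linear with
  | zero => simp
  | add p₁ p₂ h₁ h₂ => rw [map_add, map_add, h₁, h₂]
  | single v a => simp [starAddHom_single]

/-- The involution of the free `*`-algebra: the letters `x_i` are Hermitian, and the involution is
conjugate linear and reverses products. -/
instance instStarRing : StarRing (NCPoly n) where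
  star p := starAddHom n p
  star_involutive := starAddHom_starAddHom
  star_mul := starAddHom_mul
  star_add := map_add (starAddHom n)

theorem star_single (w : FreeMonoid (Fin n)) (c : ℂ) :
    star (MonoidAlgebra.single w c : NCPoly n) = MonoidAlgebra.single (star w) (star c) :=
  starAddHom_single w c

/-- The variable `x_i`. -/
def X (i : Fin n) : NCPoly n := MonoidAlgebra.single (FreeMonoid.of i) 1

theorem star_X (i : Fin n) : star (X i) = X i := by
  simp [X, star_single]

/-- The degree: the largest length of a word occurring in `p` (and `0` for `p = 0`). -/
def deg (p : NCPoly n) : ℕ := p.coeff.support.sup FreeMonoid.length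

/-- The degree of an `n`-tuple of polynomials. -/
def tupleDeg (t : Fin n → NCPoly n) : ℕ := Finset.univ.sup fun i => deg (t i)

/-- The square `‖p‖₂²` of the `2`-norm of the vector of coefficients of `p`. -/
def normSq (p : NCPoly n) : ℝ := ∑ w ∈ p.coeff.support, ‖p.coeff w‖ ^ 2

theorem deg_le_iff {p : NCPoly n} {d : ℕ} :
    deg p ≤ d ↔ ∀ w, p.coeff w ≠ 0 → w.length ≤ d := by
  simp [deg, Finset.sup_le_iff]

/-- The space `𝒫_d` of polynomials of degree at most `d`. -/
def degLE (n d : ℕ) : Submodule ℂ (NCPoly n) where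
  carrier := {p | deg p ≤ d}
  zero_mem' := by simp [deg]
  add_mem' {p q} hp hq := by
    simp only [Set.mem_ofPred_eq, deg_le_iff] at *
    intro w hw
    by_cases h : p.coeff w = 0
    · refine hq w fun h' => hw ?_
      simp [h, h']
    · exact hp w h
  smul_mem' c p hp := by
    simp only [Set.mem_ofPred_eq, deg_le_iff] at *
    intro w hw
    refine hp w fun h => hw ?_
    simp [h]

theorem mem_degLE {p : NCPoly n} {d : ℕ} : p ∈ degLE n d ↔ deg p ≤ d := Iff.rfl

theorem degLE_mono {d e : ℕ} (h : d ≤ e) : degLE n d ≤ degLE n e :=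
  fun _ hp => le_trans (mem_degLE.1 hp) h

theorem single_mem_degLE {w : FreeMonoid (Fin n)} {d : ℕ} (c : ℂ) (h : w.length ≤ d) :
    (MonoidAlgebra.single w c : NCPoly n) ∈ degLE n d := by
  rw [mem_degLE, deg_le_iff]
  intro v hv
  by_cases hvw : w = v
  · exact hvw ▸ h
  · exact absurd (by simp [MonoidAlgebra.coeff_single, hvw]) hv

/-- A polynomial is the sum of its terms. -/
theorem sum_terms (p : NCPoly n) :
    ∑ w ∈ p.coeff.support, (MonoidAlgebra.single w (p.coeff w) : NCPoly n) = p :=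
  MonoidAlgebra.sum_coeff_single p

theorem length_le_deg {p : NCPoly n} {w : FreeMonoid (Fin n)} (h : w ∈ p.coeff.support) :
    w.length ≤ deg p := Finset.le_sup (f := FreeMonoid.length) h

theorem mul_mem_degLE {p q : NCPoly n} {a b : ℕ} (hp : p ∈ degLE n a) (hq : q ∈ degLE n b) :
    p * q ∈ degLE n (a + b) := by
  rw [← sum_terms p, ← sum_terms q, Finset.sum_mul_sum]
  refine Submodule.sum_mem _ fun v hv => Submodule.sum_mem _ fun w hw => ?_
  rw [MonoidAlgebra.single_mul_single]
  refine single_mem_degLE _ ?_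
  rw [FreeMonoid.length_mul]
  exact add_le_add ((length_le_deg hv).trans hp) ((length_le_deg hw).trans hq)

theorem star_mem_degLE {p : NCPoly n} {d : ℕ} (hp : p ∈ degLE n d) : star p ∈ degLE n d := by
  rw [← sum_terms p, star_sum]
  refine Submodule.sum_mem _ fun v hv => ?_
  rw [star_single]
  refine single_mem_degLE _ ?_
  have h : (star v).length = v.length := List.length_reverse
  exact h ▸ (length_le_deg hv).trans hp

theorem mem_degLE_self (p : NCPoly n) : p ∈ degLE n (deg p) := mem_degLE.2 le_rfl

theorem mul_mem {p q : NCPoly n} {d : ℕ} (h : deg p + deg q ≤ d) : p * q ∈ degLE n d :=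
  degLE_mono h (mul_mem_degLE (mem_degLE_self p) (mem_degLE_self q))

theorem mul_star_mem {p : NCPoly n} {k : ℕ} (h : deg p ≤ k) :
    p * star p ∈ degLE n (2 * k) :=
  degLE_mono (by omega) (mul_mem_degLE (mem_degLE.2 h) (star_mem_degLE (mem_degLE.2 h)))

theorem mul_mul_star_mem {p g : NCPoly n} {k : ℕ} (h : deg p + (deg g + 1) / 2 ≤ k) :
    p * g * star p ∈ degLE n (2 * k) :=
  degLE_mono (by omega) (mul_mem_degLE (mul_mem_degLE (mem_degLE_self p) (mem_degLE_self g))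
    (star_mem_degLE (mem_degLE_self p)))

theorem mul_mul_mem {u h v : NCPoly n} {d : ℕ} (hd : deg u + deg v + deg h ≤ d) :
    u * h * v ∈ degLE n d :=
  degLE_mono (by omega) (mul_mem_degLE (mul_mem_degLE (mem_degLE_self u) (mem_degLE_self h))
    (mem_degLE_self v))

/-- Evaluation `p ↦ p(x + ε q)`, where `ε` commutes with everything and `ε² = 0`. -/
def dualEval (q : Fin n → NCPoly n) : NCPoly n →ₐ[ℂ] DualNumber (NCPoly n) :=
  MonoidAlgebra.lift ℂ (DualNumber (NCPoly n)) (FreeMonoid (Fin n))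
    (FreeMonoid.lift fun i => TrivSqZeroExt.inl (X i) + TrivSqZeroExt.inr (q i))

/-- The gradient `∇ₓp(q)`: the part of `p(x + ε q)` that is linear in `ε`. -/
def grad (p : NCPoly n) (q : Fin n → NCPoly n) : NCPoly n := (dualEval q p).snd

/-- The degree of `∇ₓp`: the derivative of a word of length `ℓ` is the sum of the terms
`u x̄_i v` obtained by varying one letter, and they all have `deg u + deg v = ℓ - 1`. -/
def gradDeg (p : NCPoly n) : ℕ := p.coeff.support.sup fun w => w.length - 1

theorem dualEval_single (q : Fin n → NCPoly n) (w : FreeMonoid (Fin n)) (c : ℂ) :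
    dualEval q (MonoidAlgebra.single w c) = c • dualEval q (MonoidAlgebra.single w 1) := by
  simp [dualEval]

theorem dualEval_single_one (q : Fin n → NCPoly n) :
    dualEval q (MonoidAlgebra.single 1 1) = 1 := by
  simp [dualEval]

theorem dualEval_single_of_mul (q : Fin n → NCPoly n) (i : Fin n) (w : FreeMonoid (Fin n)) :
    dualEval q (MonoidAlgebra.single (FreeMonoid.of i * w) 1) =
      (TrivSqZeroExt.inl (X i) + TrivSqZeroExt.inr (q i)) *
        dualEval q (MonoidAlgebra.single w 1) := by
  simp [dualEval]

theorem dualEval_single_fst (q : Fin n → NCPoly n) (w : FreeMonoid (Fin n)) :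
    (dualEval q (MonoidAlgebra.single w 1)).fst = MonoidAlgebra.single w 1 := by
  induction w using FreeMonoid.inductionOn' with
  | one => rw [dualEval_single_one, TrivSqZeroExt.fst_one]; rfl
  | of_mul i w ih =>
    rw [dualEval_single_of_mul, TrivSqZeroExt.fst_mul, ih]
    simp [X, MonoidAlgebra.single_mul_single]

theorem grad_single_one (q : Fin n → NCPoly n) : grad (MonoidAlgebra.single 1 1) q = 0 := by
  rw [grad, dualEval_single_one, TrivSqZeroExt.snd_one]

theorem grad_single_of_mul (q : Fin n → NCPoly n) (i : Fin n) (w : FreeMonoid (Fin n)) :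
    grad (MonoidAlgebra.single (FreeMonoid.of i * w) 1) q =
      X i * grad (MonoidAlgebra.single w 1) q + q i * MonoidAlgebra.single w 1 := by
  rw [grad, dualEval_single_of_mul, TrivSqZeroExt.snd_mul, dualEval_single_fst]
  simp [grad]

theorem grad_word_mem (t : Fin n → NCPoly n) (w : FreeMonoid (Fin n)) :
    grad (MonoidAlgebra.single w 1) t ∈ degLE n (w.length - 1 + tupleDeg t) := by
  induction w using FreeMonoid.inductionOn' with
  | one => rw [grad_single_one]; exact Submodule.zero_mem _
  | of_mul i w ih =>
    rw [grad_single_of_mul]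
    refine Submodule.add_mem _ ?_ ?_
    · by_cases hw : w = 1
      · subst hw
        rw [grad_single_one, mul_zero]
        exact Submodule.zero_mem _
      · have hl : w.length ≠ 0 := fun h => hw (FreeMonoid.length_eq_zero.1 h)
        refine degLE_mono ?_ (mul_mem_degLE (single_mem_degLE (d := 1) 1 (by simp)) ih)
        rw [FreeMonoid.length_mul, FreeMonoid.length_of]
        omega
    · have hi : t i ∈ degLE n (tupleDeg t) :=
        Finset.le_sup (f := fun i => deg (t i)) (Finset.mem_univ i)
      refine degLE_mono ?_ (mul_mem_degLE hi (single_mem_degLE 1 le_rfl))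
      rw [FreeMonoid.length_mul, FreeMonoid.length_of]
      omega

theorem grad_mem {p : NCPoly n} {t : Fin n → NCPoly n} {d : ℕ}
    (h : gradDeg p + tupleDeg t ≤ d) : grad p t ∈ degLE n d := by
  have hs : grad p t =
      ∑ w ∈ p.coeff.support, p.coeff w • grad (MonoidAlgebra.single w 1) t := by
    conv_lhs => rw [grad, ← sum_terms p, map_sum, TrivSqZeroExt.snd_sum]
    refine Finset.sum_congr rfl fun w _ => ?_
    rw [dualEval_single, TrivSqZeroExt.snd_smul, grad]
  rw [hs]
  refine Submodule.sum_mem _ fun w hw => Submodule.smul_mem _ _ ?_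
  refine degLE_mono ?_ (grad_word_mem t w)
  have : w.length - 1 ≤ gradDeg p :=
    Finset.le_sup (f := fun w : FreeMonoid (Fin n) => w.length - 1) hw
  omega

/-- A linear functional on `𝒫` is Hermitian if `μ(p^*) = conj(μ(p))`. -/
def IsHermitianFunctional (μ : NCPoly n →ₗ[ℂ] ℂ) : Prop := ∀ p, μ (star p) = star (μ p)

/-- A positive functional: a Hermitian linear functional with `μ(p p^*) ≥ 0` for all `p`. -/
structure IsPositiveFunctional (μ : NCPoly n →ₗ[ℂ] ℂ) : Prop where
  hermitian : IsHermitianFunctional μ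
  nonneg : ∀ p, 0 ≤ μ (p * star p)

/-- `μ` is compatible with the constraint `g(x) ≥ 0`. -/
def CompatibleIneq (μ : NCPoly n →ₗ[ℂ] ℂ) (g : NCPoly n) : Prop :=
  ∀ p, 0 ≤ μ (p * g * star p)

/-- `μ` is compatible with the constraint `h(x) = 0`. -/
def CompatibleEq (μ : NCPoly n →ₗ[ℂ] ℂ) (h : NCPoly n) : Prop :=
  ∀ u v, μ (u * h * v) = 0

end NCPoly

open NCPoly

/-- A non-commutative polynomial optimization problem: minimize `σ(f)` under the constraints
`g_i(x) ≥ 0` (`i = 1, …, m`) and `h_j(x) = 0` (`j = 1, …, m'`), for symmetric `f, g_i, h_j`. -/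
structure NPOProblem (n m m' : ℕ) where
  f : NCPoly n
  g : Fin m → NCPoly n
  h : Fin m' → NCPoly n
  f_symm : IsSelfAdjoint f
  g_symm : ∀ i, IsSelfAdjoint (g i)
  h_symm : ∀ j, IsSelfAdjoint (h j)

namespace NPOProblem

variable {n m m' : ℕ} (P : NPOProblem n m m')

/-- Feasible points `σ : 𝒫 → ℂ` of the problem. -/
structure IsFeasible (σ : NCPoly n →ₗ[ℂ] ℂ) : Prop where
  map_one : σ 1 = 1
  nonneg : ∀ p, 0 ≤ σ (p * star p)
  ineq : ∀ i, CompatibleIneq σ (P.g i)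
  eq : ∀ j, CompatibleEq σ (P.h j)

/-- Minimizers of the problem; for feasible `σ` the value `σ(f)` is real. -/
def IsMinimizer (σ : NCPoly n →ₗ[ℂ] ℂ) : Prop :=
  P.IsFeasible σ ∧ ∀ τ, P.IsFeasible τ → (σ P.f).re ≤ (τ P.f).re

/-- `p` admits a (weighted) SOS decomposition
`p = ∑ s_a^* s_a + ∑ s_{ia}^* g_i s_{ia} + ∑ u_{ja} h_j v_{ja}^* + ∑ v_{ja} h_j u_{ja}^*`. -/
def IsSOS (p : NCPoly n) : Prop :=
  ∃ (N : ℕ) (s : Fin N → NCPoly n) (s' : Fin m → Fin N → NCPoly n)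
    (u v : Fin m' → Fin N → NCPoly n),
    p = ∑ a, star (s a) * s a + ∑ i, ∑ a, star (s' i a) * P.g i * s' i a +
      ∑ j, ∑ a, u j a * P.h j * star (v j a) + ∑ j, ∑ a, v j a * P.h j * star (u j a)

/-- The Archimedean property: `K - ∑ x_i²` is SOS for some `K > 0`. -/
def IsArchimedean : Prop :=
  ∃ K : ℝ, 0 < K ∧ P.IsSOS (algebraMap ℂ (NCPoly n) K - ∑ i, X i ^ 2)

/-- The two-sided ideal `𝒥` generated by the `h_j`. -/
def idealJ : TwoSidedIdeal (NCPoly n) := TwoSidedIdeal.span (Set.range P.h)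

/-- The conditions on the multiplier `μ_i^k : 𝒫_{2k} → ℂ` of the constraint `g_i(x) ≥ 0` with
tolerance `ε` in the essential ncKKT conditions of order `k`. -/
structure IsIneqMultiplier (k : ℕ) (ε : ℝ) (i : Fin m) (μ : degLE n (2 * k) →ₗ[ℂ] ℂ) :
    Prop where
  hermitian : ∀ (p : NCPoly n) (hp : p ∈ degLE n (2 * k)),
    μ ⟨star p, star_mem_degLE hp⟩ = star (μ ⟨p, hp⟩)
  moment : ∀ (p : NCPoly n) (hp : deg p ≤ k),
    0 ≤ μ ⟨p * star p, mul_star_mem hp⟩ + ((ε * normSq p : ℝ) : ℂ)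
  localizing : ∀ (l : Fin m) (p : NCPoly n) (hp : deg p + (deg (P.g l) + 1) / 2 ≤ k),
    0 ≤ μ ⟨p * P.g l * star p, mul_mul_star_mem hp⟩ + ((ε * normSq p : ℝ) : ℂ)
  eq_zero : ∀ (j : Fin m') (u v : NCPoly n) (hd : deg u + deg v + deg (P.h j) ≤ 2 * k),
    μ ⟨u * P.h j * v, mul_mul_mem hd⟩ = 0
  slack_left : ∀ (s : NCPoly n) (hs : deg s + deg (P.g i) ≤ 2 * k),
    μ ⟨s * P.g i, mul_mem hs⟩ = 0
  slack_right : ∀ (s : NCPoly n) (hs : deg (P.g i) + deg s ≤ 2 * k),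
    μ ⟨P.g i * s, mul_mem hs⟩ = 0

/-- The conditions on a multiplier `λ_j^k : 𝒫_{2k} → ℂ` of an equality constraint in the
essential ncKKT conditions of order `k`. -/
structure IsEqMultiplier (k : ℕ) (lam : degLE n (2 * k) →ₗ[ℂ] ℂ) : Prop where
  hermitian : ∀ (p : NCPoly n) (hp : p ∈ degLE n (2 * k)),
    lam ⟨star p, star_mem_degLE hp⟩ = star (lam ⟨p, hp⟩)
  eq_zero : ∀ (j : Fin m') (u v : NCPoly n) (hd : deg u + deg v + deg (P.h j) ≤ 2 * k),
    lam ⟨u * P.h j * v, mul_mul_mem hd⟩ = 0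

/-- The degree restriction `deg ∇f, deg ∇g_i, deg ∇h_j ≤ 2k - deg t` on a tuple `t`. -/
structure DegBound (k : ℕ) (t : Fin n → NCPoly n) : Prop where
  f : gradDeg P.f + tupleDeg t ≤ 2 * k
  g : ∀ i, gradDeg (P.g i) + tupleDeg t ≤ 2 * k
  h : ∀ j, gradDeg (P.h j) + tupleDeg t ≤ 2 * k

/-- The essential ncKKT conditions of order `k` with tolerances `ε_i` at the solution `σ`. -/
def EssentialKKT (σ : NCPoly n →ₗ[ℂ] ℂ) (k : ℕ) (ε : Fin m → ℝ) : Prop :=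
  ∃ (μ : Fin m → degLE n (2 * k) →ₗ[ℂ] ℂ) (lam : Fin m' → degLE n (2 * k) →ₗ[ℂ] ℂ),
    (∀ i, P.IsIneqMultiplier k (ε i) i (μ i)) ∧
    (∀ j, P.IsEqMultiplier k (lam j)) ∧
    ∀ (t : Fin n → NCPoly n) (ht : P.DegBound k t),
      σ (grad P.f t) - ∑ i, μ i ⟨grad (P.g i) t, grad_mem (ht.g i)⟩
        - ∑ j, lam j ⟨grad (P.h j) t, grad_mem (ht.h j)⟩ = 0

end NPOProblem

end

/-! ### Differential calculus on the free `*`-algebra. -/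

noncomputable section

namespace NCPoly

variable {n : ℕ}

/-! The argument is Lagrange duality for the problem linearized at the minimizer, in two stages.

First-order optimality. By the Archimedean property, the GNS construction realizes `σ` as a vector
state on bounded self-adjoint operators `x` satisfying all the constraints
(`IsFeasible.exists_representation`). Let a Hermitian tuple `t` satisfy the linearized constraints:
each `∇g_i(t)` is SOS modulo terms `s g_i + g_i s^*`, and each `∇h_j(t)` lies in the ideal of the
equalities. Then the flow `X' = t(X)` from `x` stays feasible for a short time
(`exists_feasible_flow`): Grönwall's inequality keeps the `h_j` at zero, and an operator comparison
principle keeps the `g_i` nonnegative. The same state evaluated along the flow gives feasible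
functionals, so the derivative `σ(∇f(t))` of the objective is nonnegative
(`IsMinimizer.re_grad_nonneg`).

Exact multipliers on `I`. Relaxing the constraints of `I` by a perturbation `y` gives a cone of
pairs (perturbation, attainable derivative). The direction `q` is strictly feasible for the
constraints of `I`, and constants are order units, so a multiple of `q` absorbs every `y`. This is
the Slater-type condition that M. Riesz extension needs, and the extended functional yields the
`μ_i` on all of `𝒫` (`IsMinimizer.exists_positive_multipliers`).

Approximate multipliers for the rest. The functional `t ↦ σ(∇f(t)) - ∑ μ_i(∇g_i(t))` has nonnegative
real part on directions respecting the remaining constraints. No strict direction is assumed for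
these, and the cones cut down to degree `2k` need not be closed. Separating a compact piece of the
cone instead of the whole cone costs an error on the squares, while everything in the lineality
space is still killed exactly (`exists_dual_nonneg_add_norm_sq`, `exists_truncated_multipliers`). -/

theorem star_smul_complex (c : ℂ) (p : NCPoly n) : star (c • p) = star c • star p := by
  induction p using MonoidAlgebra.induction_linear with
  | zero => simp
  | add p q hp hq => rw [smul_add, star_add, hp, hq, star_add, smul_add]
  | single w a => simp [star_single, MonoidAlgebra.smul_single]

instance instStarModule : StarModule ℂ (NCPoly n) := ⟨star_smul_complex⟩

theorem real_smul_eq (c : ℝ) (p : NCPoly n) : c • p = (c : ℂ) • p :=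
  (Complex.coe_smul c p).symm

instance instStarModuleReal : StarModule ℝ (NCPoly n) where
  star_smul c p := by
    rw [real_smul_eq, star_smul_complex, star_trivial c, real_smul_eq, Complex.star_def,
      Complex.conj_ofReal]

theorem star_algebraMap_real (c : ℝ) :
    star (algebraMap ℂ (NCPoly n) c) = algebraMap ℂ (NCPoly n) c := by
  simp [Algebra.algebraMap_eq_smul_one]

/-- Induction on non-commutative polynomials, with words built letter by letter. -/
theorem induction_word {M : NCPoly n → Prop} (p : NCPoly n) (zero : M 0)
    (add : ∀ p q, M p → M q → M (p + q)) (smul : ∀ (c : ℂ) p, M p → M (c • p)) (one : M 1)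
    (of_mul : ∀ i p, M p → M (X i * p)) : M p := by
  induction p using MonoidAlgebra.induction_linear with
  | zero => exact zero
  | add p q hp hq => exact add p q hp hq
  | single w a =>
    have hw : M (MonoidAlgebra.single w 1) := by
      induction w using FreeMonoid.inductionOn' with
      | one => exact one
      | of_mul i w ih =>
        have := of_mul i _ ih
        rwa [X, MonoidAlgebra.single_mul_single, mul_one] at this
    simpa [MonoidAlgebra.smul_single] using smul a _ hw

theorem dualEval_X (q : Fin n → NCPoly n) (i : Fin n) :
    dualEval q (X i) = TrivSqZeroExt.inl (X i) + TrivSqZeroExt.inr (q i) := by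
  simp [dualEval, X]

theorem dualEval_fst (q : Fin n → NCPoly n) (p : NCPoly n) : (dualEval q p).fst = p := by
  induction p using induction_word with
  | zero => simp
  | add p q hp hq => rw [map_add, TrivSqZeroExt.fst_add, hp, hq]
  | smul c p hp => rw [map_smul, TrivSqZeroExt.fst_smul, hp]
  | one => rw [map_one, TrivSqZeroExt.fst_one]
  | of_mul i p hp => rw [map_mul, TrivSqZeroExt.fst_mul, hp, dualEval_X]; simp

theorem grad_mul (p p' : NCPoly n) (q : Fin n → NCPoly n) :
    grad (p * p') q = p * grad p' q + grad p q * p' := by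
  simp [grad, TrivSqZeroExt.snd_mul, dualEval_fst]

theorem grad_add_left (p p' : NCPoly n) (q : Fin n → NCPoly n) :
    grad (p + p') q = grad p q + grad p' q := by simp [grad]

theorem grad_smul_left (c : ℂ) (p : NCPoly n) (q : Fin n → NCPoly n) :
    grad (c • p) q = c • grad p q := by simp [grad]

@[simp] theorem grad_zero_left (q : Fin n → NCPoly n) : grad 0 q = 0 := by simp [grad]

@[simp] theorem grad_one (q : Fin n → NCPoly n) : grad 1 q = 0 := by simp [grad]

@[simp] theorem grad_X (q : Fin n → NCPoly n) (i : Fin n) : grad (X i) q = q i := by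
  simp [grad, dualEval_X]

/-- The gradient `q ↦ ∇p(q)` as a linear map. -/
def gradLin (p : NCPoly n) : (Fin n → NCPoly n) →ₗ[ℂ] NCPoly n where
  toFun := grad p
  map_add' q q' := by
    induction p using induction_word with
    | zero => simp
    | add p p' hp hp' => simp only [grad_add_left, hp, hp']; abel
    | smul c p hp => simp only [grad_smul_left, hp, smul_add]
    | one => simp
    | of_mul i p hp => simp only [grad_mul, hp, grad_X, Pi.add_apply, mul_add, add_mul]; abel
  map_smul' c q := by
    induction p using induction_word with
    | zero => simp
    | add p p' hp hp' => simp only [grad_add_left, hp, hp', smul_add]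
    | smul a p hp => rw [grad_smul_left, hp, grad_smul_left, RingHom.id_apply, smul_comm]
    | one => simp
    | of_mul i p hp => simp [grad_mul, hp]

@[simp] theorem gradLin_apply (p : NCPoly n) (q : Fin n → NCPoly n) :
    gradLin p q = grad p q := rfl

theorem grad_add (p : NCPoly n) (q q' : Fin n → NCPoly n) :
    grad p (q + q') = grad p q + grad p q' := map_add (gradLin p) q q'

theorem grad_smul (p : NCPoly n) (c : ℂ) (q : Fin n → NCPoly n) :
    grad p (c • q) = c • grad p q := map_smul (gradLin p) c q

/-- Since the letters are Hermitian, the involution commutes with substituting `x + ε q`. For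
Hermitian `p` this makes the Hermitian part of `∇p(t)` a derivative along the Hermitian tuple `t +
t^*`. -/
theorem star_grad (p : NCPoly n) (q : Fin n → NCPoly n) :
    star (grad p q) = grad (star p) (star q) := by
  induction p using induction_word with
  | zero => simp
  | add p p' hp hp' => simp only [grad_add_left, hp, hp', star_add]
  | smul a p hp => rw [grad_smul_left, star_smul, hp, star_smul, grad_smul_left]
  | one => simp
  | of_mul i p hp => simp [grad_mul, hp, star_X, add_comm]

end NCPoly

/-! ### The SOS cone, boundedness, and the cones of linearized constraints. -/

namespace NPOProblem

open NCPoly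

variable {n m m' : ℕ} {P : NPOProblem n m m'}

namespace IsSOS

theorem zero : P.IsSOS 0 := ⟨0, 0, 0, 0, 0, by simp⟩

theorem add {p q : NCPoly n} (hp : P.IsSOS p) (hq : P.IsSOS q) : P.IsSOS (p + q) := by
  obtain ⟨N, s, s', u, v, rfl⟩ := hp
  obtain ⟨N₂, s₂, s₂', u₂, v₂, rfl⟩ := hq
  refine ⟨N + N₂, Fin.append s s₂, fun i => Fin.append (s' i) (s₂' i),
    fun j => Fin.append (u j) (u₂ j), fun j => Fin.append (v j) (v₂ j), ?_⟩
  simp only [Fin.sum_univ_add, Fin.append_left, Fin.append_right, Finset.sum_add_distrib]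
  abel

theorem sum {ι : Type*} {t : Finset ι} {p : ι → NCPoly n} (h : ∀ i ∈ t, P.IsSOS (p i)) :
    P.IsSOS (∑ i ∈ t, p i) :=
  Finset.sum_induction _ _ (fun _ _ => add) zero h

theorem smul {p : NCPoly n} (hp : P.IsSOS p) {c : ℝ} (hc : 0 ≤ c) : P.IsSOS (c • p) := by
  obtain ⟨N, s, s', u, v, rfl⟩ := hp
  refine ⟨N, fun a => √c • s a, fun i a => √c • s' i a, fun j a => c • u j a, v, ?_⟩
  simp only [star_smul, smul_mul_assoc, mul_smul_comm, smul_smul, Finset.smul_sum, smul_add,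
    star_trivial, Real.mul_self_sqrt hc]

theorem conj {p : NCPoly n} (hp : P.IsSOS p) (b : NCPoly n) : P.IsSOS (star b * p * b) := by
  obtain ⟨N, s, s', u, v, rfl⟩ := hp
  refine ⟨N, fun a => s a * b, fun i a => s' i a * b, fun j a => star b * u j a,
    fun j a => star b * v j a, ?_⟩
  simp only [star_mul, star_star, mul_add, add_mul, Finset.mul_sum, Finset.sum_mul, mul_assoc]

theorem star_mul_self (s : NCPoly n) : P.IsSOS (star s * s) :=
  ⟨1, fun _ => s, 0, 0, 0, by simp⟩

theorem mul_star_self (s : NCPoly n) : P.IsSOS (s * star s) := by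
  simpa using star_mul_self (P := P) (star s)

theorem star_mul_ineq (i : Fin m) (s : NCPoly n) : P.IsSOS (star s * P.g i * s) := by
  classical
  refine ⟨1, 0, fun l _ => if l = i then s else 0, 0, 0, ?_⟩
  simp [apply_ite star]

theorem mul_ineq_star (i : Fin m) (s : NCPoly n) : P.IsSOS (s * P.g i * star s) := by
  simpa using star_mul_ineq (P := P) i (star s)

theorem mul_eq_mul (j : Fin m') (u v : NCPoly n) :
    P.IsSOS (u * P.h j * v + star (u * P.h j * v)) := by
  classical
  refine ⟨1, 0, 0, fun l _ => if l = j then u else 0, fun l _ => if l = j then star v else 0, ?_⟩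
  simp only [star_mul, (P.h_symm j).star_eq]
  simp [apply_ite star, mul_assoc]

theorem star_eq {p : NCPoly n} (hp : P.IsSOS p) : star p = p := by
  obtain ⟨N, s, s', u, v, rfl⟩ := hp
  simp only [star_add, star_sum, star_mul, star_star, (P.g_symm _).star_eq, (P.h_symm _).star_eq,
    mul_assoc]
  abel

theorem algebraMap {c : ℝ} (hc : 0 ≤ c) : P.IsSOS (algebraMap ℂ (NCPoly n) c) := by
  have := (star_mul_self (P := P) 1).smul hc
  rwa [star_one, mul_one, real_smul_eq, ← Algebra.algebraMap_eq_smul_one] at this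

end IsSOS

variable (P) in
/-- `p` is bounded if `c - p^*p` is SOS for some real `c`. -/
def IsBoundedPoly (p : NCPoly n) : Prop :=
  ∃ c : ℝ, 0 ≤ c ∧ P.IsSOS (algebraMap ℂ (NCPoly n) c - star p * p)

/-- Bounded elements are closed under the algebra operations, and each letter is bounded because the
other squares can be added back to `K - ∑ x_i²`. -/
theorem IsArchimedean.isBoundedPoly (hP : P.IsArchimedean) (p : NCPoly n) :
    P.IsBoundedPoly p := by
  obtain ⟨K, hK, hS⟩ := hP
  have hX : ∀ i, P.IsSOS (algebraMap ℂ (NCPoly n) K - star (X i) * X i) := by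
    intro i
    have h := hS.add (IsSOS.sum (P := P) (t := Finset.univ.erase i)
      (p := fun l => star (X l) * X l) fun l _ => IsSOS.star_mul_self _)
    rw [← Finset.add_sum_erase _ _ (Finset.mem_univ i)] at h
    convert h using 1
    simp only [star_X, ← pow_two]
    abel
  induction p using induction_word with
  | zero => exact ⟨0, le_rfl, by simpa using IsSOS.zero⟩
  | one =>
    refine ⟨1, zero_le_one, ?_⟩
    rw [Complex.ofReal_one, map_one, star_one, mul_one, sub_self]
    exact IsSOS.zero
  | add p q hp hq =>
    obtain ⟨c, hc, h⟩ := hp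
    obtain ⟨c', hc', h'⟩ := hq
    refine ⟨2 * (c + c'), by positivity, ?_⟩
    -- Parallelogram identity: `2(p^*p + q^*q) - (p+q)^*(p+q) = (p-q)^*(p-q)`.
    convert ((h.add h').smul zero_le_two).add (IsSOS.star_mul_self (p - q)) using 1
    simp only [two_smul, star_sub, star_add, Complex.ofReal_mul, Complex.ofReal_add, map_mul,
      map_add, Complex.ofReal_ofNat, map_ofNat]
    noncomm_ring
  | smul a p hp =>
    obtain ⟨c, hc, h⟩ := hp
    refine ⟨‖a‖ ^ 2 * c, by positivity, ?_⟩
    convert h.smul (sq_nonneg ‖a‖) using 1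
    have ha : a * star a = ((‖a‖ ^ 2 : ℝ) : ℂ) := by
      simpa using Complex.mul_conj' a
    rw [real_smul_eq, star_smul, smul_mul_smul_comm, mul_comm (star a), ha, smul_sub,
      Algebra.algebraMap_eq_smul_one, Algebra.algebraMap_eq_smul_one, smul_smul,
      Complex.ofReal_mul]
  | of_mul i p hp =>
    obtain ⟨c, hc, h⟩ := hp
    refine ⟨K * c, by positivity, ?_⟩
    -- `Kc - p^*x_i²p = p^*(K - x_i²)p + K(c - p^*p)`.
    convert ((hX i).conj p).add (h.smul hK.le) using 1
    rw [real_smul_eq, Algebra.algebraMap_eq_smul_one, Algebra.algebraMap_eq_smul_one,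
      Algebra.algebraMap_eq_smul_one]
    simp only [star_mul, mul_sub, sub_mul, smul_sub, mul_smul_comm, smul_mul_assoc, mul_one,
      smul_smul, Complex.ofReal_mul, mul_assoc]
    abel

/-- In an Archimedean problem, the real constants are order units. -/
theorem IsArchimedean.exists_isSOS_sub (hP : P.IsArchimedean) (p : NCPoly n) :
    ∃ c : ℝ, 0 ≤ c ∧ P.IsSOS (algebraMap ℂ (NCPoly n) c - (p + star p)) := by
  obtain ⟨c, hc, h⟩ := hP.isBoundedPoly p
  refine ⟨c + 1, by positivity, ?_⟩
  -- Expanding `(1 - p)^*(1 - p)` bounds `p + p^*` by `1 + p^*p`.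
  convert h.add (IsSOS.star_mul_self (1 - p)) using 1
  simp only [star_sub, star_one, Complex.ofReal_add, map_add, Complex.ofReal_one, map_one]
  noncomm_ring

variable (P) in
/-- The cone of polynomials whose Hermitian part is SOS modulo the terms `s g_i + g_i s^*`. -/
def slackCone (i : Fin m) : PointedCone ℝ (NCPoly n) where
  carrier := {y | ∃ s, P.IsSOS (y + star y + s * P.g i + P.g i * star s)}
  zero_mem' := ⟨0, by simpa using IsSOS.zero⟩
  add_mem' := by
    rintro y z ⟨s, hs⟩ ⟨t, ht⟩
    refine ⟨s + t, ?_⟩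
    convert hs.add ht using 1
    simp only [star_add, add_mul, mul_add]
    abel
  smul_mem' := by
    rintro ⟨c, hc⟩ y ⟨s, hs⟩
    refine ⟨c • s, ?_⟩
    convert hs.smul hc using 1
    simp [smul_add, Nonneg.mk_smul]

variable (P) in
/-- The polynomials whose Hermitian part lies in the ideal of the equality constraints. -/
def hermIdeal : Submodule ℝ (NCPoly n) where
  carrier := {y | y + star y ∈ P.idealJ}
  zero_mem' := by simp [P.idealJ.zero_mem]
  add_mem' {y z} hy hz := by
    have := P.idealJ.add_mem hy hz
    simp only [Set.mem_ofPred_eq] at *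
    convert this using 1
    rw [star_add]; abel
  smul_mem' c y hy := by
    have := P.idealJ.mul_mem_left (algebraMap ℂ (NCPoly n) c) _ hy
    simp only [Set.mem_ofPred_eq] at *
    convert this using 1
    rw [star_smul, star_trivial, ← smul_add, Algebra.algebraMap_eq_smul_one, smul_mul_assoc,
      one_mul, real_smul_eq]

theorem mem_hermIdeal {y : NCPoly n} : y ∈ P.hermIdeal ↔ y + star y ∈ P.idealJ := Iff.rfl

theorem star_mem_idealJ {p : NCPoly n} (hp : p ∈ P.idealJ) : star p ∈ P.idealJ := by
  induction hp using TwoSidedIdeal.span_induction with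
  | mem x hx =>
    obtain ⟨j, rfl⟩ := hx
    rw [(P.h_symm j).star_eq]
    exact TwoSidedIdeal.subset_span ⟨j, rfl⟩
  | zero => simp
  | add x y _ _ hx hy => simpa using P.idealJ.add_mem hx hy
  | neg x _ hx => simpa using P.idealJ.neg_mem hx
  | left_absorb a x _ hx => simpa using P.idealJ.mul_mem_right _ _ hx
  | right_absorb a x _ hx => simpa using P.idealJ.mul_mem_left _ _ hx

theorem mem_hermIdeal_of_mem {p : NCPoly n} (hp : p ∈ P.idealJ) : p ∈ P.hermIdeal :=
  P.idealJ.add_mem hp (star_mem_idealJ hp)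

theorem mul_eq_mul_mem_idealJ (j : Fin m') (u v : NCPoly n) : u * P.h j * v ∈ P.idealJ :=
  P.idealJ.mul_mem_right _ _ (P.idealJ.mul_mem_left _ _ (TwoSidedIdeal.subset_span ⟨j, rfl⟩))

theorem IsSOS.mem_slackCone {p : NCPoly n} (hp : P.IsSOS p) (i : Fin m) : p ∈ P.slackCone i :=
  ⟨0, by simpa [hp.star_eq] using hp.add hp⟩

theorem IsSOS.add_star_mem_slackCone {p : NCPoly n} (hp : P.IsSOS (p + star p)) (i : Fin m) :
    p ∈ P.slackCone i := ⟨0, by simpa using hp⟩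

/-- The opposite of a skew element is skew, so these lie in the lineality space. A functional
vanishing there is determined by Hermitian parts, which makes its complex extension Hermitian. -/
theorem skew_mem_slackCone {p : NCPoly n} (hp : p + star p = 0) (i : Fin m) :
    p ∈ P.slackCone i := IsSOS.add_star_mem_slackCone (hp ▸ IsSOS.zero) i

theorem mul_eq_mul_mem_slackCone (j : Fin m') (u v : NCPoly n) (i : Fin m) :
    u * P.h j * v ∈ P.slackCone i := IsSOS.add_star_mem_slackCone (IsSOS.mul_eq_mul j u v) i

/-- The free slack term cancels the Hermitian part completely. Applied to `±s`, this is the source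
of complementary slackness for the multipliers. -/
theorem mul_ineq_mem_slackCone (i : Fin m) (s : NCPoly n) : s * P.g i ∈ P.slackCone i :=
  ⟨-s, by simpa [(P.g_symm i).star_eq] using IsSOS.zero⟩

theorem ineq_mul_mem_slackCone (i : Fin m) (s : NCPoly n) : P.g i * s ∈ P.slackCone i :=
  ⟨-star s, by
    have : P.g i * s + star (P.g i * s) + -star s * P.g i + P.g i * star (-star s) = 0 := by
      simp [(P.g_symm i).star_eq]
    rw [this]; exact IsSOS.zero⟩

end NPOProblem
end

/-! ### Separation from a possibly non-closed cone in finite dimension. -/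

noncomputable section

/-- In finite dimension, the convex hull of a compact set is compact. -/
theorem IsCompact.convexHull_of_finiteDimensional {E : Type*} [NormedAddCommGroup E]
    [NormedSpace ℝ E] [FiniteDimensional ℝ E] {s : Set E} (hs : IsCompact s) :
    IsCompact (convexHull ℝ s) := by
  -- Carathéodory: at most `finrank + 1` points are needed, so the hull is a finite union of
  -- continuous images of compact sets.
  have h : convexHull ℝ s = ⋃ k ∈ Set.Iic (Module.finrank ℝ E + 1),
      (fun x : (Fin k → ℝ) × (Fin k → E) => ∑ i, x.1 i • x.2 i) ''
        (stdSimplex ℝ (Fin k) ×ˢ Set.univ.pi fun _ => s) := by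
    apply Set.Subset.antisymm
    · intro x hx
      obtain ⟨ι, _, z, w, hz, hind, hw, hw1, hx⟩ := eq_pos_convex_span_of_mem_convexHull hx
      simp only [Set.mem_iUnion]
      let e := (Fintype.equivFin ι).symm
      refine ⟨Fintype.card ι, hind.card_le_finrank_succ.trans ?_, (w ∘ e, z ∘ e),
        ⟨⟨?_, ?_⟩, ?_⟩, ?_⟩
      · exact Nat.succ_le_succ (Submodule.finrank_le _)
      · exact fun i => (hw _).le
      · exact (e.sum_comp w).trans hw1
      · exact fun i _ => hz ⟨_, rfl⟩
      · exact (e.sum_comp fun i => w i • z i).trans hx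
    · intro x hx
      simp only [Set.mem_iUnion] at hx
      obtain ⟨k, -, ⟨w, z⟩, ⟨hw, hz⟩, rfl⟩ := hx
      exact (convex_convexHull ℝ s).sum_mem (fun i _ => hw.1 i) hw.2
        fun i _ => subset_convexHull ℝ s (hz i trivial)
  rw [h]
  refine (Set.finite_Iic _).isCompact_biUnion fun k _ => ?_
  exact ((isCompact_stdSimplex ℝ (Fin k)).prod (isCompact_univ_pi fun _ => hs)).image (by fun_prop)

/-- The cone `C` may fail to be closed, so only the compact hull of the `B i v v` with `‖v‖ ≤ 1` is
separated, at height `-1`, from the graph of `L` over `A`. Homogeneity then extends the bound to all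
`v`, with error `‖v‖ ^ 2`. -/
theorem exists_dual_nonneg_add_norm_sq_aux {E : Type*} [NormedAddCommGroup E] [NormedSpace ℝ E]
    [FiniteDimensional ℝ E] {ι : Type*} [Finite ι] {V : ι → Type*}
    [∀ i, NormedAddCommGroup (V i)] [∀ i, NormedSpace ℝ (V i)] [∀ i, FiniteDimensional ℝ (V i)]
    (B : ∀ i, V i →ₗ[ℝ] V i →ₗ[ℝ] E) (C : PointedCone ℝ E) (hB : ∀ i v, B i v v ∈ C)
    {T : Type*} [AddCommGroup T] [Module ℝ T] (A : T →ₗ[ℝ] E) (L : T →ₗ[ℝ] ℝ)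
    (h : ∀ t, A t ∈ C → 0 ≤ L t) :
    ∃ ν : E →ₗ[ℝ] ℝ, (∀ t, ν (A t) = L t) ∧ ∀ i v, 0 ≤ ν (B i v v) + ‖v‖ ^ 2 := by
  have hcont : ∀ i, Continuous fun v => B i v v := by
    intro i
    have : Continuous (LinearMap.toContinuousLinearMap.toLinearMap ∘ₗ B i) :=
      LinearMap.continuous_of_finiteDimensional _
    exact this.clm_apply continuous_id
  -- Including `0` forces the vertical coefficient `β` of the separating functional to be positive.
  let K₀ : Set E := insert 0 (⋃ i, (fun v => B i v v) '' Metric.closedBall 0 1)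
  have hK₀ : IsCompact K₀ := by
    refine IsCompact.insert (isCompact_iUnion fun i => ?_) 0
    have := FiniteDimensional.proper ℝ (V i)
    exact (isCompact_closedBall 0 1).image (hcont i)
  have hK : IsCompact (convexHull ℝ K₀) := hK₀.convexHull_of_finiteDimensional
  have hKC : convexHull ℝ K₀ ⊆ C := by
    refine convexHull_min ?_ C.convex
    refine Set.insert_subset C.zero_mem (Set.iUnion_subset fun i => ?_)
    rintro _ ⟨v, -, rfl⟩
    exact hB i v
  let S : Submodule ℝ (E × ℝ) := LinearMap.range (A.prod L)
  have hdisj : Disjoint (convexHull ℝ K₀ ×ˢ {(-1 : ℝ)}) (S : Set (E × ℝ)) := by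
    rw [Set.disjoint_left]
    rintro _ ⟨hc, hc1⟩ ⟨t, rfl⟩
    have h1 : L t = -1 := hc1
    have := h t (hKC hc)
    linarith
  obtain ⟨φ, u, v, hu, huv, hv⟩ := geometric_hahn_banach_compact_closed
    ((convex_convexHull ℝ K₀).prod (convex_singleton (-1 : ℝ))) (hK.prod isCompact_singleton)
    S.convex S.closed_of_finiteDimensional hdisj
  have hv0 : v < 0 := by simpa using hv 0 S.zero_mem
  -- A linear functional bounded below on a subspace vanishes on it.
  have hS : ∀ x ∈ S, φ x = 0 := by
    intro x hx
    by_contra hne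
    have := hv _ (S.smul_mem (v / φ x) hx)
    rw [map_smul, smul_eq_mul, div_mul_cancel₀ _ hne] at this
    exact lt_irrefl _ this
  have hsplit : ∀ e a, φ (e, a) = φ (e, 0) + a * φ (0, 1) := by
    intro e a
    rw [← smul_eq_mul, ← map_smul, ← map_add]
    simp
  set β := φ (0, 1) with hβ
  have hlt : ∀ c ∈ convexHull ℝ K₀, φ (c, 0) < β := by
    intro c hc
    have := hu (c, -1) ⟨hc, rfl⟩
    rw [hsplit] at this
    linarith
  have hβ0 : 0 < β := by
    have := hlt 0 (subset_convexHull ℝ _ (Set.mem_insert _ _))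
    have h0 : φ ((0 : E), (0 : ℝ)) = 0 := map_zero φ
    rwa [h0] at this
  refine ⟨(-β⁻¹) • (φ.toLinearMap ∘ₗ LinearMap.inl ℝ E ℝ), fun t => ?_, fun i v => ?_⟩
  · have := hS _ ⟨t, rfl⟩
    change φ (A t, L t) = 0 at this
    rw [hsplit] at this
    have h2 : φ (A t, 0) = -(L t * β) := by linarith
    simp [h2]
    field_simp
  · have key : ∀ w : V i, ‖w‖ ≤ 1 → φ (B i w w, 0) < β := fun w hw =>
      hlt _ (subset_convexHull ℝ _ (Or.inr (Set.mem_iUnion.2 ⟨i, w, by simpa using hw, rfl⟩)))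
    have hq : φ (B i v v, 0) ≤ ‖v‖ ^ 2 * β := by
      rcases eq_or_ne v 0 with rfl | hv
      · have h0 : φ ((0 : E), (0 : ℝ)) = 0 := map_zero φ
        simp [h0]
      · have hn : ‖v‖ ≠ 0 := norm_ne_zero_iff.2 hv
        have := key (‖v‖⁻¹ • v) (by rw [norm_smul, norm_inv, norm_norm, inv_mul_cancel₀ hn])
        have h3 : ((B i) (‖v‖⁻¹ • v) (‖v‖⁻¹ • v), (0 : ℝ)) = (‖v‖ ^ 2)⁻¹ • (B i v v, (0 : ℝ)) := by
          simp [smul_smul, pow_two]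
        rw [h3, map_smul, smul_eq_mul, inv_mul_lt_iff₀ (by positivity)] at this
        exact this.le
    have : β⁻¹ * φ (B i v v, 0) ≤ ‖v‖ ^ 2 := by
      rw [inv_mul_le_iff₀ hβ0]; linarith
    simp
    linarith

/-- Strict separation in finite dimension: a linear functional on a subspace that is nonnegative
on a cone extends to a functional that vanishes on the lineality space of the cone and is
nonnegative, up to the error `‖v‖ ^ 2`, on elements `B_i v v` of the cone. -/
theorem exists_dual_nonneg_add_norm_sq {E : Type*} [AddCommGroup E] [Module ℝ E]
    [FiniteDimensional ℝ E] {ι : Type*} [Finite ι] {V : ι → Type*}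
    [∀ i, NormedAddCommGroup (V i)] [∀ i, NormedSpace ℝ (V i)] [∀ i, FiniteDimensional ℝ (V i)]
    (B : ∀ i, V i →ₗ[ℝ] V i →ₗ[ℝ] E) (C : PointedCone ℝ E) (hB : ∀ i v, B i v v ∈ C)
    {T : Type*} [AddCommGroup T] [Module ℝ T] (A : T →ₗ[ℝ] E) (L : T →ₗ[ℝ] ℝ)
    (h : ∀ t, A t ∈ C → 0 ≤ L t) :
    ∃ ν : E →ₗ[ℝ] ℝ, (∀ t, ν (A t) = L t) ∧ (∀ w ∈ C, -w ∈ C → ν w = 0) ∧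
      ∀ i v, 0 ≤ ν (B i v v) + ‖v‖ ^ 2 := by
  let e : E ≃ₗ[ℝ] (Fin (Module.finrank ℝ E) → ℝ) := LinearEquiv.ofFinrankEq _ _ (by simp)
  have hmem : ∀ x, e x ∈ C.map e.toLinearMap ↔ x ∈ C := by
    intro x
    rw [PointedCone.mem_map]
    exact ⟨fun ⟨y, hy, hyx⟩ => e.injective hyx ▸ hy, fun hx => ⟨x, hx, rfl⟩⟩
  -- The lineality space is added to the domain with objective `0`, which forces `ν` to vanish on
  -- it. Adding a lineality element does not change membership in `C`, so the hypothesis persists.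
  -- The coordinates `e` only supply a norm.
  obtain ⟨ν, h1, h2⟩ := exists_dual_nonneg_add_norm_sq_aux
    (fun i => (B i).compr₂ e.toLinearMap) (C.map e.toLinearMap)
    (fun i v => (hmem _).2 (hB i v)) (T := T × C.lineal)
    (e.toLinearMap ∘ₗ (A.coprod C.lineal.subtype)) (L ∘ₗ LinearMap.fst ℝ _ _) (by
      rintro ⟨t, w, hw⟩ htw
      refine h t ?_
      have h3 : A t + w ∈ C := (hmem _).1 htw
      have h4 : -w ∈ C := (PointedCone.mem_lineal.1 hw).2
      have := C.add_mem h3 h4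
      rwa [add_neg_cancel_right] at this)
  refine ⟨ν ∘ₗ e.toLinearMap, fun t => ?_, fun w hw hw' => ?_, fun i v => h2 i v⟩
  · simpa using h1 (t, 0)
  · simpa using h1 (0, ⟨w, PointedCone.mem_lineal.2 ⟨hw, hw'⟩⟩)

end

/-! ### Comparison principle and polynomial flows in `C^*`-algebras. -/

noncomputable section

open Filter Topology Set

section Comparison

variable {A : Type*} [CStarAlgebra A] [PartialOrder A] [StarOrderedRing A]

theorem neg_smul_one_le_of_norm_le {a : A} (ha : IsSelfAdjoint a) {c : ℝ} (h : ‖a‖ ≤ c) :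
    -(c • (1 : A)) ≤ a := by
  refine le_trans ?_ ha.neg_algebraMap_norm_le_self
  rw [Algebra.algebraMap_eq_smul_one, neg_le_neg_iff]
  exact smul_le_smul_of_nonneg_right h zero_le_one

theorem star_mul_self_le_smul_one (a : A) : star a * a ≤ ‖a‖ ^ 2 • (1 : A) := by
  have := CStarAlgebra.star_mul_le_algebraMap_norm_sq (a := a)
  rwa [Algebra.algebraMap_eq_smul_one] at this

/-- A curve through `0` with strictly positive velocity is positive for a short time. -/
theorem eventually_nonneg_of_hasDerivAt {F : ℝ → A} {D : A} {τ e : ℝ}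
    (hF : HasDerivAt F D τ) (h0 : F τ = 0) (he : 0 < e) (hD : e • (1 : A) ≤ D)
    (hsa : ∀ᶠ s in 𝓝[>] τ, IsSelfAdjoint (F s)) : ∀ᶠ s in 𝓝[>] τ, 0 ≤ F s := by
  have h1 := (hF.isLittleO.def he).filter_mono (nhdsWithin_le_nhds (s := Ioi τ))
  have hDsa : IsSelfAdjoint D := by
    have : IsSelfAdjoint (D - e • (1 : A)) := IsSelfAdjoint.of_nonneg (sub_nonneg.2 hD)
    have he : IsSelfAdjoint (e • (1 : A)) := (IsSelfAdjoint.all e).smul (.one A)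
    simpa using this.add he
  filter_upwards [h1, hsa, self_mem_nhdsWithin] with s hs hsa hsτ
  have hpos : 0 < s - τ := sub_pos.2 hsτ
  rw [h0, sub_zero, Real.norm_of_nonneg hpos.le] at hs
  have h2 := neg_smul_one_le_of_norm_le (hsa.sub ((IsSelfAdjoint.all (s - τ)).smul hDsa)) hs
  have h3 : (s - τ) • (e • (1 : A)) ≤ (s - τ) • D := smul_le_smul_of_nonneg_left hD hpos.le
  have h4 := add_le_add h2 h3
  rw [sub_add_cancel, smul_smul, mul_comm, neg_add_cancel] at h4
  exact h4

/-- Comparison principle for `G_i' = R_i - c_i G_i - G_i c_i^*`, where `R_i` is nonnegative up to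
the negative parts of the `G_l`. -/
theorem nonneg_of_hasDerivAt_of_comparison {ι : Type*} [Finite ι] {G R c : ι → ℝ → A} {C T : ℝ}
    (hsa : ∀ i, ∀ τ, IsSelfAdjoint (G i τ))
    (hderiv : ∀ i, ∀ τ ∈ Icc 0 T,
      HasDerivAt (G i) (R i τ - (c i τ * G i τ + G i τ * star (c i τ))) τ)
    (h0 : ∀ i, 0 ≤ G i 0) (hc : ∀ i, ∀ τ ∈ Icc 0 T, ‖c i τ‖ ≤ C)
    (hR : ∀ τ ∈ Icc 0 T, ∀ η : ℝ, 0 ≤ η → (∀ l, -(η • (1 : A)) ≤ G l τ) →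
      ∀ i, -((C * η) • (1 : A)) ≤ R i τ) :
    ∀ τ ∈ Icc 0 T, ∀ i, 0 ≤ G i τ := by
  -- Each `G i` is lifted by an exponential barrier and positivity is propagated by continuous
  -- induction. In the rate `3C + 1`, one `C` pays for `R`, `2C` pays for `c + c^*`, and `1` leaves
  -- a strictly positive velocity.
  have key : ∀ η : ℝ, 0 < η → Icc 0 T ⊆
      {τ | ∀ i, 0 ≤ G i τ + (η * Real.exp ((3 * C + 1) * τ)) • (1 : A)} := by
    intro η hη
    have hcont : ∀ i, ContinuousOn
        (fun τ => G i τ + (η * Real.exp ((3 * C + 1) * τ)) • (1 : A)) (Icc 0 T) := by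
      intro i
      refine ContinuousOn.add (fun τ hτ => (hderiv i τ hτ).continuousAt.continuousWithinAt) ?_
      fun_prop
    refine IsClosed.Icc_subset_of_forall_mem_nhdsWithin ?_ ?_ ?_
    · have : {τ | ∀ i, 0 ≤ G i τ + (η * Real.exp ((3 * C + 1) * τ)) • (1 : A)} ∩ Icc 0 T =
          Icc 0 T ∩ ⋂ i, (Icc 0 T ∩ (fun τ => G i τ + (η * Real.exp ((3 * C + 1) * τ)) • (1 : A)) ⁻¹'
            Ici 0) := by
        ext τ; simp only [mem_inter_iff, mem_ofPred_eq, mem_iInter, mem_preimage, mem_Ici]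
        exact ⟨fun h => ⟨h.2, fun i => ⟨h.2, h.1 i⟩⟩, fun h => ⟨fun i => (h.2 i).2, h.1⟩⟩
      rw [this]
      exact isClosed_Icc.inter (isClosed_iInter fun i =>
        (hcont i).preimage_isClosed_of_isClosed isClosed_Icc isClosed_Ici)
    · intro i
      exact add_nonneg (h0 i) (smul_nonneg (by positivity) zero_le_one)
    · rintro τ ⟨hτ, hτT⟩
      have hτ' : τ ∈ Icc 0 T := Ico_subset_Icc_self hτT
      set e := η * Real.exp ((3 * C + 1) * τ) with he
      have he0 : 0 < e := by positivity
      rw [mem_ofPred_eq] at hτ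
      have hlow : ∀ l, -(e • (1 : A)) ≤ G l τ := fun l => neg_le_iff_add_nonneg.2 (hτ l)
      have hev : ∀ i, ∀ᶠ s in 𝓝[>] τ,
          0 ≤ G i s + (η * Real.exp ((3 * C + 1) * s)) • (1 : A) := by
        intro i
        set Q := G i τ + e • (1 : A) with hQ
        -- The terms `-cG - Gc^*` have no useful lower bound in the operator order. They are, to
        -- first order, the effect of conjugating by `u`, which preserves positivity. After
        -- subtracting `u Q u^*`, only `R`, the barrier's growth and `e(c + c^*)` remain in the
        -- derivative.
        let u : ℝ → A := fun s => 1 - (s - τ) • c i τ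
        have hu : HasDerivAt u (-c i τ) τ := by
          have := (((hasDerivAt_id τ).sub_const τ).smul_const (c i τ)).const_sub 1
          simpa using this
        have hexp : HasDerivAt (fun s => (η * Real.exp ((3 * C + 1) * s)) • (1 : A))
            (((3 * C + 1) * e) • (1 : A)) τ := by
          have h1 : HasDerivAt (fun s => (3 * C + 1) * s) (3 * C + 1) τ := by
            simpa using (hasDerivAt_id τ).const_mul (3 * C + 1)
          have h2 : (3 * C + 1) * e = η * (Real.exp ((3 * C + 1) * τ) * (3 * C + 1)) := by
            rw [he]; ring
          rw [h2]
          exact (h1.exp.const_mul η).smul_const (1 : A)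
        have hF := ((hderiv i τ hτ').add hexp).sub ((hu.mul_const Q).mul hu.star)
        have hu0 : u τ = 1 := by simp [u]
        have h2 : ∀ᶠ s in 𝓝[>] τ, 0 ≤ (G i s + (η * Real.exp ((3 * C + 1) * s)) • (1 : A)) -
            u s * Q * star (u s) := by
          refine eventually_nonneg_of_hasDerivAt hF ?_ he0 ?_ ?_
          · simp [hu0, hQ, he]
          · have hcs : -((2 * C) • (1 : A)) ≤ c i τ + star (c i τ) := by
              refine neg_smul_one_le_of_norm_le (IsSelfAdjoint.add_star_self _) ?_
              refine (norm_add_le _ _).trans ?_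
              rw [norm_star]
              linarith [hc i τ hτ']
            have h3 := add_le_add (hR τ hτ' e he0.le hlow i)
              (smul_le_smul_of_nonneg_left hcs he0.le)
            have h4 := add_le_add_left h3 (((3 * C + 1) * e) • (1 : A))
            convert h4 using 1
            · rw [smul_neg, smul_smul, ← neg_smul, ← neg_smul, ← add_smul, ← add_smul]
              congr 1; ring
            · simp only [hu0, hQ, star_one, star_neg, mul_one, one_mul, mul_neg, neg_mul, add_mul,
                mul_add, smul_mul_assoc, mul_smul_comm, smul_add, smul_neg]
              abel
          · refine Eventually.of_forall fun s => ?_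
            refine IsSelfAdjoint.sub ((hsa i s).add (.smul (.all _) (.one A))) ?_
            exact IsSelfAdjoint.conjugate ((hsa i τ).add (.smul (.all _) (.one A))) _
        filter_upwards [h2] with s hs
        have := add_nonneg hs (star_right_conjugate_nonneg (hτ i) (u s))
        rwa [sub_add_cancel] at this
      exact eventually_all.2 hev
  intro τ hτ i
  -- The barrier is removed by letting `η` tend to `0`.
  have hlim : Tendsto (fun η : ℝ => G i τ + (η * Real.exp ((3 * C + 1) * τ)) • (1 : A)) (𝓝[>] 0)
      (𝓝 (G i τ + (0 * Real.exp ((3 * C + 1) * τ)) • (1 : A))) := by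
    refine Tendsto.mono_left (Continuous.tendsto ?_ 0) nhdsWithin_le_nhds
    fun_prop
  rw [zero_mul, zero_smul, add_zero] at hlim
  refine ge_of_tendsto hlim ?_
  filter_upwards [self_mem_nhdsWithin] with η hη using key η hη hτ i

end Comparison

namespace NCPoly

variable {n : ℕ} {A : Type*} [CStarAlgebra A]

/-- Evaluation of non-commutative polynomials at a tuple of elements of an algebra. -/
def evalAt (x : Fin n → A) : NCPoly n →ₐ[ℂ] A :=
  MonoidAlgebra.lift ℂ A (FreeMonoid (Fin n)) (FreeMonoid.lift x)

@[simp] theorem evalAt_X (x : Fin n → A) (i : Fin n) : evalAt x (X i) = x i := by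
  simp [evalAt, X]

theorem evalAt_star {x : Fin n → A} (hx : ∀ i, IsSelfAdjoint (x i)) (p : NCPoly n) :
    evalAt x (star p) = star (evalAt x p) := by
  induction p using induction_word with
  | zero => simp
  | add p q hp hq => simp [hp, hq]
  | smul c p hp => simp [hp, star_smul]
  | one => simp
  | of_mul i p hp => simp [hp, star_X, (hx i).star_eq]

theorem contDiff_evalAt (p : NCPoly n) :
    ContDiff ℝ 1 fun y : Fin n → selfAdjoint A => evalAt (fun k => (y k : A)) p := by
  induction p using induction_word with
  | zero => simpa using contDiff_const
  | add p q hp hq => simpa using hp.add hq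
  | smul c p hp => simpa using hp.const_smul c
  | one => simpa using contDiff_const
  | of_mul i p hp =>
    simp only [map_mul, evalAt_X]
    refine ContDiff.mul ?_ hp
    have : ContDiff ℝ 1 fun z : selfAdjoint A => (z : A) :=
      (selfAdjoint.submodule ℝ A).subtypeL.contDiff
    exact this.comp (contDiff_apply ℝ (selfAdjoint A) i)

/-- The local flow of the vector field `X' = t(X)` on tuples of self-adjoint elements. -/
theorem exists_flow {t : Fin n → NCPoly n} (ht : ∀ k, IsSelfAdjoint (t k)) {x : Fin n → A}
    (hx : ∀ k, IsSelfAdjoint (x k)) :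
    ∃ α : ℝ → Fin n → A, α 0 = x ∧ (∀ τ k, IsSelfAdjoint (α τ k)) ∧ ∃ ε > 0, ∀ τ ∈ Ioo (-ε) ε,
      ∀ p, HasDerivAt (fun s => evalAt (α s) p) (evalAt (α τ) (grad p t)) τ := by
  -- The equation is solved in the real Banach space of self-adjoint tuples, so solutions are
  -- self-adjoint by construction. Taking the self-adjoint part changes nothing, because `t` is
  -- Hermitian.
  let F : (Fin n → selfAdjoint A) → Fin n → selfAdjoint A := fun y k =>
    selfAdjointPartL ℝ A (evalAt (fun l => (y l : A)) (t k))
  have : CompleteSpace (selfAdjoint A) :=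
    (isClosed_eq continuous_star continuous_id).completeSpace_coe
  have hF : ContDiff ℝ 1 F :=
    contDiff_pi.2 fun k => (selfAdjointPartL ℝ A).contDiff.comp (contDiff_evalAt (t k))
  have hFt : ∀ y k, (F y k : A) = evalAt (fun l => (y l : A)) (t k) := by
    intro y k
    have : IsSelfAdjoint (evalAt (fun l => (y l : A)) (t k)) := by
      rw [IsSelfAdjoint, ← evalAt_star fun l => (y l).2, (ht k).star_eq]
    exact this.coe_selfAdjointPart_apply ℝ
  obtain ⟨α, h0, ε, hε, hα⟩ :=
    (hF.contDiffAt (x := fun k => ⟨x k, hx k⟩)).exists_forall_mem_closedBall_exists_eq_forall_mem_Ioo_hasDerivAt₀ 0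
  refine ⟨fun τ k => α τ k, by simp [h0], fun τ k => (α τ k).2, ε, hε, fun τ hτ p => ?_⟩
  have hd : ∀ k, HasDerivAt (fun s => (α s k : A)) (evalAt (fun l => (α τ l : A)) (t k)) τ := by
    intro k
    have h1 := hasDerivAt_pi.1 (hα τ (by simpa using hτ)) k
    have h2 := (selfAdjoint.submodule ℝ A).subtypeL.hasFDerivAt.comp_hasDerivAt τ h1
    rw [← hFt]
    exact h2
  induction p using induction_word with
  | zero => simpa using hasDerivAt_const τ (0 : A)
  | add p q hp hq =>
    simp only [map_add, grad_add_left]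
    exact hp.add hq
  | smul c p hp =>
    simp only [map_smul, grad_smul_left]
    exact hp.const_smul c
  | one => simpa using hasDerivAt_const τ (1 : A)
  | of_mul i p hp =>
    simp only [map_mul, evalAt_X, grad_mul, grad_X, map_add]
    rw [add_comm]
    exact (hd i).mul hp

end NCPoly
end

/-! ### Feasible flows and the derivative of the objective. -/

noncomputable section

open Filter Topology Set NCPoly

/-- The derivative at the left end point of a minimizer is nonnegative. -/
theorem nonneg_of_hasDerivAt_of_isMinOn {F : ℝ → ℝ} {D T : ℝ} (hT : 0 < T)
    (hF : HasDerivAt F D 0) (hmin : ∀ τ ∈ Icc 0 T, F 0 ≤ F τ) : 0 ≤ D := by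
  have h : Tendsto (slope F 0) (𝓝[>] 0) (𝓝 D) := (hasDerivAt_iff_tendsto_slope.1 hF).mono_left
    (nhdsWithin_mono 0 fun x (hx : 0 < x) => hx.ne')
  refine ge_of_tendsto h ?_
  filter_upwards [Ioo_mem_nhdsGT hT] with τ hτ
  rw [slope_def_field, sub_zero]
  exact div_nonneg (sub_nonneg.2 (hmin τ ⟨hτ.1.le, hτ.2.le⟩)) hτ.1.le

namespace NPOProblem

variable {n m m' : ℕ} {P : NPOProblem n m m'} {A : Type*} [CStarAlgebra A]

/-- Applied to `∇h_j(t)`, this turns ideal membership into a linear differential inequality for the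
tuple of the `h_j` along the flow. -/
theorem exists_norm_evalAt_le_of_mem_idealJ {S : Set ℝ} {α : ℝ → Fin n → A}
    (hb : ∀ p : NCPoly n, ∃ C, 0 ≤ C ∧ ∀ τ ∈ S, ‖evalAt (α τ) p‖ ≤ C) {p : NCPoly n}
    (hp : p ∈ P.idealJ) :
    ∃ C, 0 ≤ C ∧ ∀ τ ∈ S, ‖evalAt (α τ) p‖ ≤ C * ‖fun j => evalAt (α τ) (P.h j)‖ := by
  induction hp using TwoSidedIdeal.span_induction with
  | mem x hx =>
    obtain ⟨j, rfl⟩ := hx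
    refine ⟨1, zero_le_one, fun τ _ => ?_⟩
    rw [one_mul]
    exact norm_le_pi_norm (fun j => evalAt (α τ) (P.h j)) j
  | zero => exact ⟨0, le_rfl, by simp⟩
  | add x y _ _ hx hy =>
    obtain ⟨C, hC, h⟩ := hx
    obtain ⟨C', hC', h'⟩ := hy
    refine ⟨C + C', by positivity, fun τ hτ => ?_⟩
    rw [map_add, add_mul]
    exact (norm_add_le _ _).trans (add_le_add (h τ hτ) (h' τ hτ))
  | neg x _ hx => simpa using hx
  | left_absorb a x _ hx =>
    obtain ⟨C, hC, h⟩ := hx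
    obtain ⟨C', hC', h'⟩ := hb a
    refine ⟨C' * C, by positivity, fun τ hτ => ?_⟩
    rw [map_mul, mul_assoc]
    exact (norm_mul_le _ _).trans (mul_le_mul (h' τ hτ) (h τ hτ) (norm_nonneg _) hC')
  | right_absorb a x _ hx =>
    obtain ⟨C, hC, h⟩ := hx
    obtain ⟨C', hC', h'⟩ := hb a
    refine ⟨C * C', by positivity, fun τ hτ => ?_⟩
    rw [map_mul, mul_right_comm]
    exact (norm_mul_le _ _).trans (mul_le_mul (h τ hτ) (h' τ hτ) (norm_nonneg _)
      (by positivity))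

variable [PartialOrder A] [StarOrderedRing A]

/-- Where the equalities hold, only the terms `s^*g_l s` can be negative, and `g_l ≥ -η` gives
`s^*g_l s ≥ -η‖s‖²`. The constant is uniform over `S` because the evaluations are. -/
theorem IsSOS.exists_neg_le_evalAt {S : Set ℝ} {α : ℝ → Fin n → A}
    (hα : ∀ τ k, IsSelfAdjoint (α τ k))
    (hb : ∀ p : NCPoly n, ∃ C, 0 ≤ C ∧ ∀ τ ∈ S, ‖evalAt (α τ) p‖ ≤ C)
    (hh : ∀ τ ∈ S, ∀ j, evalAt (α τ) (P.h j) = 0) {p : NCPoly n} (hp : P.IsSOS p) :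
    ∃ C, 0 ≤ C ∧ ∀ τ ∈ S, ∀ η : ℝ, 0 ≤ η → (∀ l, -(η • (1 : A)) ≤ evalAt (α τ) (P.g l)) →
      -((C * η) • (1 : A)) ≤ evalAt (α τ) p := by
  obtain ⟨N, s, s', u, v, rfl⟩ := hp
  choose C hC0 hC using hb
  refine ⟨∑ i, ∑ a, C (s' i a) ^ 2, Finset.sum_nonneg fun i _ => Finset.sum_nonneg fun a _ =>
    sq_nonneg _, fun τ hτ η hη hg => ?_⟩
  simp only [map_add, map_sum, map_mul, hh τ hτ, mul_zero, zero_mul, Finset.sum_const_zero,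
    add_zero, evalAt_star (hα τ)]
  have h1 : (0 : A) ≤ ∑ a, star (evalAt (α τ) (s a)) * evalAt (α τ) (s a) :=
    Finset.sum_nonneg fun a _ => star_mul_self_nonneg _
  have h2 : ∀ i a, -((C (s' i a) ^ 2 * η) • (1 : A)) ≤
      star (evalAt (α τ) (s' i a)) * evalAt (α τ) (P.g i) * evalAt (α τ) (s' i a) := by
    intro i a
    refine le_trans ?_ (star_left_conjugate_le_conjugate (hg i) _)
    rw [mul_neg, neg_mul, neg_le_neg_iff, mul_smul_comm, mul_one, smul_mul_assoc, mul_comm,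
      mul_smul]
    refine smul_le_smul_of_nonneg_left ((star_mul_self_le_smul_one _).trans ?_) hη
    exact smul_le_smul_of_nonneg_right (pow_le_pow_left₀ (norm_nonneg _) (hC _ τ hτ) 2)
      zero_le_one
  have h3 := Finset.sum_le_sum fun i (_ : i ∈ Finset.univ) =>
    Finset.sum_le_sum fun a (_ : a ∈ Finset.univ) => h2 i a
  have h4 := add_le_add h1 h3
  rw [zero_add] at h4
  convert h4 using 1
  simp only [Finset.sum_neg_distrib, Finset.sum_mul, Finset.sum_smul]

/-- The flow along a feasible direction stays in the feasible set for a short time. -/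
theorem exists_feasible_flow {t : Fin n → NCPoly n} (ht : ∀ k, IsSelfAdjoint (t k))
    (hg : ∀ i, ∃ s, P.IsSOS (grad (P.g i) t + s * P.g i + P.g i * star s))
    (hh : ∀ j, grad (P.h j) t ∈ P.idealJ) {x : Fin n → A} (hx : ∀ k, IsSelfAdjoint (x k))
    (hxg : ∀ i, 0 ≤ evalAt x (P.g i)) (hxh : ∀ j, evalAt x (P.h j) = 0) :
    ∃ α : ℝ → Fin n → A, α 0 = x ∧ (∀ τ k, IsSelfAdjoint (α τ k)) ∧
      (∀ p, HasDerivAt (fun s => evalAt (α s) p) (evalAt x (grad p t)) 0) ∧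
      ∃ T > 0, ∀ τ ∈ Icc 0 T, (∀ i, 0 ≤ evalAt (α τ) (P.g i)) ∧
        ∀ j, evalAt (α τ) (P.h j) = 0 := by
  obtain ⟨α, h0, hα, ε, hε, hd⟩ := exists_flow ht hx
  have hmem : ∀ τ ∈ Icc 0 (ε / 2), τ ∈ Ioo (-ε) ε := fun τ hτ =>
    ⟨by linarith [hτ.1], by linarith [hτ.2]⟩
  have hb : ∀ p : NCPoly n, ∃ C, 0 ≤ C ∧ ∀ τ ∈ Icc 0 (ε / 2), ‖evalAt (α τ) p‖ ≤ C := by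
    intro p
    have hcont : ContinuousOn (fun s => evalAt (α s) p) (Icc 0 (ε / 2)) := fun τ hτ =>
      (hd τ (hmem τ hτ) p).continuousAt.continuousWithinAt
    obtain ⟨C, hC⟩ := isCompact_Icc.exists_bound_of_continuousOn hcont
    exact ⟨max C 0, le_max_right _ _, fun τ hτ => (hC τ hτ).trans (le_max_left _ _)⟩
  -- Grönwall's inequality from a zero initial value; the sum of the `C j` serves all coordinates of
  -- the sup norm.
  have hH : ∀ τ ∈ Icc 0 (ε / 2), (fun j => evalAt (α τ) (P.h j)) = 0 := by
    choose C hC0 hC using fun j => exists_norm_evalAt_le_of_mem_idealJ hb (hh j)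
    have hHd : ∀ τ ∈ Icc 0 (ε / 2), HasDerivAt (fun s j => evalAt (α s) (P.h j))
        (fun j => evalAt (α τ) (grad (P.h j) t)) τ := fun τ hτ =>
      hasDerivAt_pi.2 fun j => hd τ (hmem τ hτ) (P.h j)
    refine eq_zero_of_abs_deriv_le_mul_abs_self_of_eq_zero_right (K := ∑ j, C j)
      (fun τ hτ => (hHd τ hτ).continuousAt.continuousWithinAt)
      (fun τ hτ => (hHd τ (Ico_subset_Icc_self hτ)).hasDerivWithinAt) ?_ ?_
    · funext j
      simpa [h0] using hxh j
    · intro τ hτ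
      refine (pi_norm_le_iff_of_nonneg ?_).2 fun j => (hC j τ (Ico_subset_Icc_self hτ)).trans ?_
      · exact mul_nonneg (Finset.sum_nonneg fun j _ => hC0 j) (norm_nonneg _)
      · exact mul_le_mul_of_nonneg_right
          (Finset.single_le_sum (fun j _ => hC0 j) (Finset.mem_univ j)) (norm_nonneg _)
  have hH' : ∀ τ ∈ Icc 0 (ε / 2), ∀ j, evalAt (α τ) (P.h j) = 0 := fun τ hτ =>
    congrFun (hH τ hτ)
  refine ⟨α, h0, hα, fun p => by simpa [h0] using hd 0 ⟨by linarith, hε⟩ p, ε / 2, by linarith,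
    fun τ hτ => ⟨?_, hH' τ hτ⟩⟩
  choose s hs using hg
  choose C₁ hC₁0 hC₁ using fun i => (hs i).exists_neg_le_evalAt hα hb hH'
  choose C₂ hC₂0 hC₂ using fun i => hb (s i)
  have hC₁' : ∀ i, C₁ i ≤ ∑ i, (C₁ i + C₂ i) := fun i => by
    refine le_trans ?_ (Finset.single_le_sum (f := fun i => C₁ i + C₂ i)
      (fun i _ => add_nonneg (hC₁0 i) (hC₂0 i)) (Finset.mem_univ i))
    exact le_add_of_nonneg_right (hC₂0 i)
  have hC₂' : ∀ i, C₂ i ≤ ∑ i, (C₁ i + C₂ i) := fun i => by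
    refine le_trans ?_ (Finset.single_le_sum (f := fun i => C₁ i + C₂ i)
      (fun i _ => add_nonneg (hC₁0 i) (hC₂0 i)) (Finset.mem_univ i))
    exact le_add_of_nonneg_left (hC₁0 i)
  -- With `R` the SOS expression, `∇g_i(t) = R - s_i g_i - g_i s_i^*` is exactly the form the
  -- comparison principle handles.
  refine nonneg_of_hasDerivAt_of_comparison (G := fun i τ => evalAt (α τ) (P.g i))
    (R := fun i τ => evalAt (α τ) (grad (P.g i) t + s i * P.g i + P.g i * star (s i)))
    (c := fun i τ => evalAt (α τ) (s i)) (C := ∑ i, (C₁ i + C₂ i)) ?_ ?_ ?_ ?_ ?_ τ hτ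
  · intro i τ
    rw [IsSelfAdjoint, ← evalAt_star (hα τ), (P.g_symm i).star_eq]
  · intro i τ hτ
    convert hd τ (hmem τ hτ) (P.g i) using 1
    simp only [map_add, map_mul, evalAt_star (hα τ)]
    abel
  · intro i
    simpa [h0] using hxg i
  · intro i τ hτ
    exact (hC₂ i τ hτ).trans (hC₂' i)
  · intro τ hτ η hη hlow i
    refine le_trans ?_ (hC₁ i τ hτ η hη hlow)
    rw [neg_le_neg_iff]
    exact smul_le_smul_of_nonneg_right (mul_le_mul_of_nonneg_right (hC₁' i) hη) zero_le_one

/-- Nonnegativity of the derivative of the objective along feasible directions, for a minimizer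
that is represented by a positive functional on a `C^*`-algebra. -/
theorem IsMinimizer.re_grad_nonneg_of_representation {σ : NCPoly n →ₗ[ℂ] ℂ}
    (hσ : P.IsMinimizer σ) {t : Fin n → NCPoly n} (ht : ∀ k, IsSelfAdjoint (t k))
    (hg : ∀ i, ∃ s, P.IsSOS (grad (P.g i) t + s * P.g i + P.g i * star s))
    (hh : ∀ j, grad (P.h j) t ∈ P.idealJ) {x : Fin n → A} (hx : ∀ k, IsSelfAdjoint (x k))
    (hxg : ∀ i, 0 ≤ evalAt x (P.g i)) (hxh : ∀ j, evalAt x (P.h j) = 0)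
    (φ : A →L[ℂ] ℂ) (hφ : ∀ a, 0 ≤ a → 0 ≤ φ a) (hφσ : ∀ p, φ (evalAt x p) = σ p) :
    0 ≤ (σ (grad P.f t)).re := by
  obtain ⟨α, h0, hα, hd, T, hT, hfeas⟩ := exists_feasible_flow ht hg hh hx hxg hxh
  have hF : HasDerivAt (fun s => (φ (evalAt (α s) P.f)).re) (σ (grad P.f t)).re 0 := by
    have h1 : HasDerivAt (fun s => φ (evalAt (α s) P.f)) (φ (evalAt x (grad P.f t))) 0 :=
      (φ.restrictScalars ℝ).hasFDerivAt.comp_hasDerivAt 0 (hd P.f)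
    rw [← hφσ]
    exact Complex.reCLM.hasFDerivAt.comp_hasDerivAt 0 h1
  -- The fixed state `φ` composed with evaluation at `α τ` is again feasible, so the objective along
  -- the flow is minimal at `τ = 0`.
  refine nonneg_of_hasDerivAt_of_isMinOn hT hF fun τ hτ => ?_
  obtain ⟨hgτ, hhτ⟩ := hfeas τ hτ
  have hmin := hσ.2 (φ.toLinearMap ∘ₗ (evalAt (α τ)).toLinearMap) ⟨?_, ?_, ?_, ?_⟩
  · simpa [h0, hφσ] using hmin
  · have h1 := hφσ 1
    rw [hσ.1.map_one, map_one] at h1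
    simpa using h1
  · intro p
    simp only [LinearMap.comp_apply, AlgHom.toLinearMap_apply, map_mul, evalAt_star (hα τ)]
    exact hφ _ (mul_star_self_nonneg _)
  · intro i p
    simp only [LinearMap.comp_apply, AlgHom.toLinearMap_apply, map_mul, evalAt_star (hα τ)]
    exact hφ _ (star_right_conjugate_nonneg (hgτ i) _)
  · intro j u v
    simp [hhτ j]

end NPOProblem
end

/-! ### GNS representation and first-order optimality. -/

noncomputable section

open NCPoly

namespace NCPoly

variable {n : ℕ}

/-- Polarization: reality on the squares of `1 + p` and `1 + i p` determines the imaginary and real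
parts of `σ(p^*)`. -/
theorem isHermitianFunctional_of_nonneg {σ : NCPoly n →ₗ[ℂ] ℂ} (h : ∀ p, 0 ≤ σ (p * star p)) :
    IsHermitianFunctional σ := by
  intro p
  have him : ∀ p, (σ (p * star p)).im = 0 := fun p => ((Complex.le_def.1 (h p)).2).symm
  have h0 := him p
  have h1 := him 1
  have h2 := him (1 + p)
  have h3 := him (1 + Complex.I • p)
  simp only [star_one, star_add, add_mul, mul_add, one_mul, mul_one, map_add, star_smul,
    map_smul, smul_mul_assoc, mul_smul_comm, Complex.add_im, smul_eq_mul, Complex.star_def,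
    Complex.conj_I, Complex.mul_im, Complex.neg_im, Complex.I_re, Complex.I_im,
    neg_mul, Complex.mul_re] at h1 h2 h3
  apply Complex.ext
  · simp only [Complex.star_def, Complex.conj_re]
    linarith
  · simp only [Complex.star_def, Complex.conj_im]
    linarith

/-- The space of polynomials, with the semi-inner product of a positive functional. -/
def PreGNS (_σ : NCPoly n →ₗ[ℂ] ℂ) : Type := NCPoly n

instance (σ : NCPoly n →ₗ[ℂ] ℂ) : AddCommGroup (PreGNS σ) := inferInstanceAs (AddCommGroup (NCPoly n))

instance (σ : NCPoly n →ₗ[ℂ] ℂ) : Module ℂ (PreGNS σ) := inferInstanceAs (Module ℂ (NCPoly n))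

/-- The identity map from the space of polynomials to the pre-Hilbert space of a functional. -/
def toPreGNS (σ : NCPoly n →ₗ[ℂ] ℂ) : NCPoly n ≃ₗ[ℂ] PreGNS σ := LinearEquiv.refl ℂ _

/-- The semi-inner product `⟪a, b⟫ = σ(a^* b)`. -/
@[reducible]
def preGNSCore {σ : NCPoly n →ₗ[ℂ] ℂ} (h : ∀ p, 0 ≤ σ (p * star p)) :
    PreInnerProductSpace.Core ℂ (PreGNS σ) where
  inner a b := σ (star ((toPreGNS σ).symm a) * (toPreGNS σ).symm b)
  conj_inner_symm a b := by
    have := isHermitianFunctional_of_nonneg h (star ((toPreGNS σ).symm b) * (toPreGNS σ).symm a)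
    rw [star_mul, star_star] at this
    exact this.symm
  re_inner_nonneg a := by
    have := h (star ((toPreGNS σ).symm a))
    rw [star_star] at this
    exact (Complex.le_def.1 this).1
  add_left a b c := by simp [add_mul]
  smul_left a b c := by simp [star_smul]

end NCPoly

namespace NPOProblem

variable {n m m' : ℕ} {P : NPOProblem n m m'} {σ : NCPoly n →ₗ[ℂ] ℂ}

theorem IsFeasible.nonneg_of_isSOS (hσ : P.IsFeasible σ) {p : NCPoly n} (hp : P.IsSOS p) :
    0 ≤ σ p := by
  obtain ⟨N, s, s', u, v, rfl⟩ := hp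
  simp only [map_add, map_sum]
  refine add_nonneg (add_nonneg (add_nonneg ?_ ?_) ?_) ?_
  · exact Finset.sum_nonneg fun a _ => by simpa using hσ.nonneg (star (s a))
  · exact Finset.sum_nonneg fun i _ => Finset.sum_nonneg fun a _ => by
      simpa using hσ.ineq i (star (s' i a))
  · exact Finset.sum_nonneg fun j _ => Finset.sum_nonneg fun a _ => (hσ.eq j _ _).ge
  · exact Finset.sum_nonneg fun j _ => Finset.sum_nonneg fun a _ => (hσ.eq j _ _).ge

/-- The Gelfand–Naimark–Segal representation of a feasible point. -/
theorem IsFeasible.exists_representation (hP : P.IsArchimedean) (hσ : P.IsFeasible σ) :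
    ∃ (H : Type) (_ : NormedAddCommGroup H) (_ : InnerProductSpace ℂ H) (_ : CompleteSpace H)
      (x : Fin n → H →L[ℂ] H) (ψ : H), (∀ k, IsSelfAdjoint (x k)) ∧
      (∀ i, 0 ≤ evalAt x (P.g i)) ∧ (∀ j, evalAt x (P.h j) = 0) ∧
      ∀ p, inner ℂ ψ (evalAt x p ψ) = σ p := by
  let core := preGNSCore hσ.nonneg
  let _ : SeminormedAddCommGroup (PreGNS σ) :=
    InnerProductSpace.Core.toSeminormedAddCommGroup (c := core)
  let _ : InnerProductSpace ℂ (PreGNS σ) := InnerProductSpace.ofCore core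
  have hinner : ∀ a b : NCPoly n, inner ℂ (toPreGNS σ a) (toPreGNS σ b) = σ (star a * b) :=
    fun _ _ => rfl
  have hnorm : ∀ a : NCPoly n, ‖toPreGNS σ a‖ ^ 2 = (σ (star a * a)).re := fun a => by
    rw [← hinner, ← inner_self_eq_norm_sq (𝕜 := ℂ)]
    rfl
  have hbd : ∀ k, ∃ C : ℝ, ∀ a : PreGNS σ,
      ‖toPreGNS σ (X k * (toPreGNS σ).symm a)‖ ≤ C * ‖a‖ := by
    intro k
    -- Conjugating `c - x_k²` by `a` and applying `σ` gives `‖x_k a‖² ≤ c‖a‖²`. Hence left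
    -- multiplication extends to the completion, which also identifies null vectors with zero.
    obtain ⟨c, hc, hS⟩ := hP.isBoundedPoly (X k)
    refine ⟨√c, fun a => ?_⟩
    obtain ⟨a, rfl⟩ := (toPreGNS σ).surjective a
    rw [LinearEquiv.symm_apply_apply]
    refine abs_le_of_sq_le_sq' ?_ (by positivity) |>.2
    rw [mul_pow, Real.sq_sqrt hc, hnorm, hnorm]
    have h1 := (Complex.le_def.1 (hσ.nonneg_of_isSOS (hS.conj a))).1
    rw [Algebra.algebraMap_eq_smul_one, mul_sub, sub_mul, mul_smul_comm, smul_mul_assoc, mul_one,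
      map_sub, map_smul, smul_eq_mul, Complex.sub_re, Complex.re_ofReal_mul, Complex.zero_re] at h1
    rw [star_mul, mul_assoc, ← mul_assoc (star (X k))]
    rw [mul_assoc] at h1
    linarith
  choose C hC using hbd
  let L : Fin n → PreGNS σ →L[ℂ] PreGNS σ := fun k =>
    ((toPreGNS σ).toLinearMap ∘ₗ LinearMap.mulLeft ℂ (X k) ∘ₗ
      (toPreGNS σ).symm.toLinearMap).mkContinuous (C k) (hC k)
  let x : Fin n → UniformSpace.Completion (PreGNS σ) →L[ℂ] UniformSpace.Completion (PreGNS σ) :=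
    fun k => (L k).completion
  have hx : ∀ p a, evalAt x p (toPreGNS σ a : UniformSpace.Completion (PreGNS σ)) = (toPreGNS σ (p * a) :
      UniformSpace.Completion (PreGNS σ)) := by
    intro p
    induction p using induction_word with
    | zero =>
      intro a
      rw [map_zero, zero_mul, map_zero, zero_apply, UniformSpace.Completion.coe_zero]
    | add p q hp hq =>
      intro a
      rw [map_add, add_apply, hp, hq, add_mul, map_add,
        UniformSpace.Completion.coe_add]
    | smul c p hp =>
      intro a
      rw [map_smul, smul_apply, hp, smul_mul_assoc, map_smul,
        UniformSpace.Completion.coe_smul]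
    | one => intro a; simp
    | of_mul i p hp =>
      intro a
      rw [map_mul, mul_apply_eq_comp, hp, evalAt_X, mul_assoc]
      exact ContinuousLinearMap.completion_apply_coe _ _
  have hxsa : ∀ k, IsSelfAdjoint (x k) := by
    intro k
    rw [ContinuousLinearMap.isSelfAdjoint_iff_isSymmetric]
    intro a b
    induction a, b using UniformSpace.Completion.induction_on₂ with
    | hp => apply isClosed_eq <;> fun_prop
    | ih a b =>
      obtain ⟨a, rfl⟩ := (toPreGNS σ).surjective a
      obtain ⟨b, rfl⟩ := (toPreGNS σ).surjective b
      have h1 := hx (X k) a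
      have h2 := hx (X k) b
      rw [evalAt_X] at h1 h2
      simp only [ContinuousLinearMap.coe_coe]
      rw [h1, h2, UniformSpace.Completion.inner_coe, UniformSpace.Completion.inner_coe, hinner,
        hinner, star_mul, star_X, mul_assoc]
  refine ⟨UniformSpace.Completion (PreGNS σ), inferInstance, inferInstance, inferInstance, x,
    (toPreGNS σ 1 : UniformSpace.Completion (PreGNS σ)), hxsa, ?_, ?_, ?_⟩
  · intro i
    rw [ContinuousLinearMap.nonneg_iff_isPositive, ContinuousLinearMap.isPositive_def']
    refine ⟨?_, fun a => ?_⟩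
    · rw [IsSelfAdjoint, ← evalAt_star hxsa, (P.g_symm i).star_eq]
    · induction a using UniformSpace.Completion.induction_on with
      | hp =>
        refine isClosed_le continuous_const ?_
        exact ContinuousLinearMap.reApplyInnerSelf_continuous _
      | ih a =>
        obtain ⟨a, rfl⟩ := (toPreGNS σ).surjective a
        rw [ContinuousLinearMap.reApplyInnerSelf, hx, ← inner_conj_symm, RCLike.conj_re,
          UniformSpace.Completion.inner_coe, hinner]
        have := hσ.ineq i (star a)
        rw [star_star, mul_assoc] at this
        exact (Complex.le_def.1 this).1
  · intro j
    ext a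
    induction a using UniformSpace.Completion.induction_on with
    | hp => apply isClosed_eq <;> fun_prop
    | ih a =>
      obtain ⟨a, rfl⟩ := (toPreGNS σ).surjective a
      rw [hx, zero_apply, ← norm_eq_zero, UniformSpace.Completion.norm_coe,
        ← sq_eq_zero_iff, hnorm, star_mul, ← mul_assoc]
      have := hσ.eq j (star a * star (P.h j)) a
      rw [this, Complex.zero_re]
  · intro p
    rw [hx, UniformSpace.Completion.inner_coe, hinner, star_one, one_mul, mul_one]

/-- The objective does not decrease along feasible directions at a minimizer. -/
theorem IsMinimizer.re_grad_nonneg (hP : P.IsArchimedean) (hσ : P.IsMinimizer σ)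
    {t : Fin n → NCPoly n} (hg : ∀ i, grad (P.g i) t ∈ P.slackCone i)
    (hh : ∀ j, grad (P.h j) t ∈ P.hermIdeal) : 0 ≤ (σ (grad P.f t)).re := by
  obtain ⟨H, _, _, _, x, ψ, hx, hxg, hxh, hxσ⟩ := hσ.1.exists_representation hP
  let φ : (H →L[ℂ] H) →L[ℂ] ℂ :=
    (innerSL ℂ ψ).comp (ContinuousLinearMap.apply ℂ H ψ)
  have hherm : ∀ p : NCPoly n, IsSelfAdjoint p →
      grad p (t + star t) = grad p t + star (grad p t) := fun p hp => by
    rw [grad_add, star_grad, hp.star_eq]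
  -- The cone conditions concern Hermitian parts, that is, derivatives along the Hermitian tuple `t
  -- + t^*`. The resulting value is twice the real part sought.
  have h := hσ.re_grad_nonneg_of_representation (t := t + star t) (x := x) (φ := φ)
    (fun k => IsSelfAdjoint.add_star_self (t k))
    (fun i => by rw [hherm _ (P.g_symm i)]; exact hg i)
    (fun j => by rw [hherm _ (P.h_symm j)]; exact hh j) hx hxg hxh
    (fun a ha => (((ContinuousLinearMap.nonneg_iff_isPositive a).1 ha).inner_nonneg_right ψ))
    (fun p => hxσ p)
  rw [hherm _ P.f_symm, map_add, isHermitianFunctional_of_nonneg hσ.1.nonneg] at h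
  simp only [Complex.add_re, Complex.star_def, Complex.conj_re] at h
  linarith

end NPOProblem
end

/-! ### Complex functionals from real ones, and exact multipliers by Riesz extension. -/

noncomputable section

open NCPoly

theorem LinearMap.eq_of_re_eq {F : Type*} [AddCommGroup F] [Module ℂ F] {μ μ' : F →ₗ[ℂ] ℂ}
    (h : ∀ x, (μ x).re = (μ' x).re) (x : F) : μ x = μ' x := by
  apply Complex.ext (h x)
  have := h (Complex.I • x)
  simpa using this

section ComplexExtension

variable {F : Type*} [AddCommGroup F] [Module ℝ F] [Module ℂ F] [IsScalarTower ℝ ℂ F]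

/-- The complex linear functional with a given real part. -/
def complexExt (ν : F →ₗ[ℝ] ℝ) : F →ₗ[ℂ] ℂ := Module.Dual.extendRCLike (𝕜 := ℂ) ν

@[simp] theorem complexExt_re (ν : F →ₗ[ℝ] ℝ) (x : F) : (complexExt ν x).re = ν x :=
  Module.Dual.re_extendRCLike_apply (𝕜 := ℂ) ν x

theorem complexExt_im (ν : F →ₗ[ℝ] ℝ) (x : F) : (complexExt ν x).im = -ν (Complex.I • x) :=
  Module.Dual.im_extendRCLike_apply (𝕜 := ℂ) ν x

theorem complexExt_eq_zero {ν : F →ₗ[ℝ] ℝ} {x : F} (h : ν x = 0) (h' : ν (Complex.I • x) = 0) :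
    complexExt ν x = 0 :=
  Complex.ext (by simpa using h) (by simpa [complexExt_im] using h')

theorem complexExt_star {ν : F →ₗ[ℝ] ℝ} {S : F → F} (hν : ∀ x, ν (S x) = ν x)
    (hS : ∀ x, S (Complex.I • x) = -(Complex.I • S x)) (x : F) :
    complexExt ν (S x) = star (complexExt ν x) := by
  apply Complex.ext
  · simpa using hν x
  · have := hν (Complex.I • x)
    rw [hS, map_neg] at this
    simp [complexExt_im, this]

theorem Complex.nonneg_of_star_eq {z : ℂ} (h : star z = z) (h0 : 0 ≤ z.re) : 0 ≤ z := by
  refine Complex.le_def.2 ⟨h0, ?_⟩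
  have := congrArg Complex.im h
  simp only [Complex.star_def, Complex.conj_im] at this
  simp only [Complex.zero_im]
  linarith

end ComplexExtension

namespace NCPoly

variable {n : ℕ}

theorem grad_smul_real (p : NCPoly n) (c : ℝ) (q : Fin n → NCPoly n) :
    grad p (c • q) = c • grad p q := (gradLin p).map_smul_of_tower c q

end NCPoly

namespace NPOProblem

variable {n m m' : ℕ} {P : NPOProblem n m m'} {σ : NCPoly n →ₗ[ℂ] ℂ}

theorem mem_slackCone_of_isSOS {i : Fin m} {y s : NCPoly n} (hy : star y = y)
    (h : P.IsSOS (y + s * P.g i + P.g i * star s)) : y ∈ P.slackCone i := by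
  refine ⟨s + s, ?_⟩
  convert h.add h using 1
  rw [hy, star_add, add_mul, mul_add]
  abel

/-- Nonnegativity on a cone forces vanishing on its lineality space. Skew elements, `u h_j v`, `p
g_i` and `g_i p` all lie there; the last three families are also stable under multiplication by `i`,
so the imaginary part of the extension vanishes on them too. -/
theorem isPositiveFunctional_complexExt {i : Fin m} {ν : NCPoly n →ₗ[ℝ] ℝ}
    (hν : ∀ y ∈ P.slackCone i, 0 ≤ ν y) :
    IsPositiveFunctional (complexExt ν) ∧ (∀ l, CompatibleIneq (complexExt ν) (P.g l)) ∧
      (∀ j, CompatibleEq (complexExt ν) (P.h j)) ∧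
      ∀ p, complexExt ν (p * P.g i) = 0 ∧ complexExt ν (P.g i * p) = 0 := by
  have hlin : ∀ y, y ∈ P.slackCone i → -y ∈ P.slackCone i → ν y = 0 := fun y h h' => by
    have := hν _ h
    have := hν _ h'
    rw [map_neg] at this
    linarith
  have hzero : ∀ y, y ∈ P.slackCone i → -y ∈ P.slackCone i → Complex.I • y ∈ P.slackCone i →
      -(Complex.I • y) ∈ P.slackCone i → complexExt ν y = 0 := fun y h₁ h₂ h₃ h₄ =>
    complexExt_eq_zero (hlin y h₁ h₂) (hlin _ h₃ h₄)
  have hherm : IsHermitianFunctional (complexExt ν) := by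
    intro p
    refine complexExt_star (S := star) (fun x => ?_) (fun x => by simp [star_smul]) p
    have := hlin (star x - x) (skew_mem_slackCone (by simp) i) (skew_mem_slackCone (by simp) i)
    rw [map_sub] at this
    linarith
  have hSOS : ∀ y, P.IsSOS y → 0 ≤ complexExt ν y := fun y hy => by
    refine Complex.nonneg_of_star_eq ?_ ?_
    · rw [← hherm, hy.star_eq]
    · simpa using hν y (hy.mem_slackCone i)
  refine ⟨⟨hherm, fun p => hSOS _ (IsSOS.mul_star_self p)⟩,
    fun l p => hSOS _ (IsSOS.mul_ineq_star l p), fun j u v => ?_, fun p => ⟨?_, ?_⟩⟩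
  · have := fun u : NCPoly n => mul_eq_mul_mem_slackCone (P := P) j u v i
    refine hzero _ (this _) ?_ ?_ ?_
    · simpa using this (-u)
    · simpa using this (Complex.I • u)
    · simpa using this (-(Complex.I • u))
  · have := mul_ineq_mem_slackCone (P := P) i
    refine hzero _ (this _) ?_ ?_ ?_
    · simpa using this (-p)
    · simpa using this (Complex.I • p)
    · simpa using this (-(Complex.I • p))
  · have := ineq_mul_mem_slackCone (P := P) i
    refine hzero _ (this _) ?_ ?_ ?_
    · simpa using this (-p)
    · simpa using this (Complex.I • p)
    · simpa using this (-(Complex.I • p))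

variable (P) in
/-- The tuples along which the constraints outside `I` and the equality constraints are satisfied
to first order. -/
def directionCone (I : Finset (Fin m)) : PointedCone ℝ (Fin n → NCPoly n) where
  carrier := {t | (∀ i ∉ I, grad (P.g i) t ∈ P.slackCone i) ∧
    ∀ j, grad (P.h j) t ∈ P.hermIdeal}
  zero_mem' := by
    have h0 : ∀ p : NCPoly n, grad p 0 = 0 := fun p => map_zero (gradLin p)
    exact ⟨fun i _ => by rw [h0]; exact zero_mem _, fun j => by rw [h0]; exact zero_mem _⟩
  add_mem' {t t'} h h' :=
    ⟨fun i hi => by rw [grad_add]; exact add_mem (h.1 i hi) (h'.1 i hi),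
      fun j => by rw [grad_add]; exact add_mem (h.2 j) (h'.2 j)⟩
  smul_mem' c t h :=
    ⟨fun i hi => by
        have := Submodule.smul_mem _ c (h.1 i hi)
        rwa [Nonneg.mk_smul, ← grad_smul_real] at this,
      fun j => by
        have := Submodule.smul_mem _ (c : ℝ) (h.2 j)
        rwa [← grad_smul_real] at this⟩

variable (P) in
/-- The graph cone of the perturbed linearized problem: pairs `(y, a)` such that some direction
`t` satisfies the constraints of `I` relaxed by `y`, with directional derivative at most `a`. -/
def perturbationCone (σ : NCPoly n →ₗ[ℂ] ℂ) (I : Finset (Fin m)) :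
    PointedCone ℝ ((I → NCPoly n) × ℝ) where
  carrier := {x | ∃ t ∈ P.directionCone I, (σ (grad P.f t)).re ≤ x.2 ∧
    ∀ i : I, grad (P.g i) t - x.1 i ∈ P.slackCone i}
  zero_mem' := by
    have h0 : ∀ p : NCPoly n, grad p 0 = 0 := fun p => map_zero (gradLin p)
    exact ⟨0, zero_mem _, by simp [h0], fun i => by simp [h0, zero_mem]⟩
  add_mem' := by
    rintro x x' ⟨t, ht, hx, hy⟩ ⟨t', ht', hx', hy'⟩
    refine ⟨t + t', add_mem ht ht', ?_, fun i => ?_⟩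
    · rw [grad_add, map_add, Complex.add_re]
      exact add_le_add hx hx'
    · convert add_mem (hy i) (hy' i) using 1
      rw [grad_add, Prod.fst_add, Pi.add_apply]
      abel
  smul_mem' := by
    rintro ⟨c, hc⟩ x ⟨t, ht, hx, hy⟩
    refine ⟨c • t, (P.directionCone I).smul_mem hc ht, ?_, fun i => ?_⟩
    · rw [grad_smul_real, real_smul_eq, map_smul, smul_eq_mul, Complex.re_ofReal_mul]
      exact mul_le_mul_of_nonneg_left hx hc
    · convert (P.slackCone (i : Fin m)).smul_mem hc (hy i) using 1
      simp [grad_smul_real, smul_sub]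

/-- Exact multipliers for the constraints in `I`. -/
theorem IsMinimizer.exists_positive_multipliers (hP : P.IsArchimedean) (hσ : P.IsMinimizer σ)
    {I : Finset (Fin m)} {r : ℝ} (hr : 0 < r) {q : Fin n → NCPoly n}
    (hq : ∀ a, IsSelfAdjoint (q a)) {s : Fin m → NCPoly n}
    (hI : ∀ i ∈ I, P.IsSOS (grad (P.g i) q + s i * P.g i + P.g i * star (s i)
      - algebraMap ℂ (NCPoly n) r))
    (hIc : ∀ i ∉ I, P.IsSOS (grad (P.g i) q + s i * P.g i + P.g i * star (s i)))
    (hJ : ∀ j, grad (P.h j) q ∈ P.idealJ) :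
    ∃ μ : I → NCPoly n →ₗ[ℂ] ℂ,
      (∀ i, IsPositiveFunctional (μ i) ∧ (∀ l, CompatibleIneq (μ i) (P.g l)) ∧
        (∀ j, CompatibleEq (μ i) (P.h j)) ∧
        ∀ p, μ i (p * P.g i) = 0 ∧ μ i (P.g i * p) = 0) ∧
      ∀ t ∈ P.directionCone I,
        ∑ i, (μ i (grad (P.g i) t)).re ≤ (σ (grad P.f t)).re := by
  classical
  have hgq : ∀ i, star (grad (P.g i) q) = grad (P.g i) q := fun i => by
    rw [star_grad, (P.g_symm i).star_eq, show star q = q from funext fun a => (hq a).star_eq]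
  have hqdir : q ∈ P.directionCone I :=
    ⟨fun i hi => mem_slackCone_of_isSOS (hgq i) (hIc i hi), fun j => mem_hermIdeal_of_mem (hJ j)⟩
  let D : Submodule ℝ ((I → NCPoly n) × ℝ) := LinearMap.range (LinearMap.inr ℝ (I → NCPoly n) ℝ)
  let F : ((I → NCPoly n) × ℝ) →ₗ.[ℝ] ℝ := ⟨D, LinearMap.snd ℝ _ _ ∘ₗ D.subtype⟩
  -- The functional to extend reads off `a` on the axis `y = 0`. It is nonnegative on the cone there
  -- because an unperturbed direction is feasible for every constraint, so first-order optimality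
  -- applies.
  obtain ⟨G, hGF, hG⟩ := riesz_extension (P.perturbationCone σ I) F (by
    rintro ⟨_, a, rfl⟩ ⟨t, ht, hta, hy⟩
    refine le_trans (hσ.re_grad_nonneg hP (fun i => ?_) ht.2) hta
    by_cases hi : i ∈ I
    · simpa using hy ⟨i, hi⟩
    · exact ht.1 i hi) (by
    rintro ⟨y, a⟩
    -- Slater step: `C q` gains a margin `C r ≥ c i` in every constraint of `I` at once, which
    -- absorbs the perturbation `y`.
    choose c hc0 hc using fun i => hP.exists_isSOS_sub (y i)
    set C := (∑ i, c i) / r with hC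
    have hC0 : 0 ≤ C := div_nonneg (Finset.sum_nonneg fun i _ => hc0 i) hr.le
    refine ⟨⟨(0, (σ (grad P.f (C • q))).re - a), _, rfl⟩, C • q,
      (P.directionCone I).smul_mem hC0 hqdir, by simp, fun i => ?_⟩
    have h1 : grad (P.g i) q - algebraMap ℂ (NCPoly n) r ∈ P.slackCone i := by
      refine mem_slackCone_of_isSOS (s := s i) ?_ ?_
      · rw [star_sub, hgq, star_algebraMap_real]
      · convert hI i i.2 using 1
        abel
    have h2 : algebraMap ℂ (NCPoly n) ((C * r : ℝ) : ℂ) - y i ∈ P.slackCone i := by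
      refine IsSOS.add_star_mem_slackCone ?_ _
      have hle : 0 ≤ C * r + (C * r - c i) := by
        have h3 : c i ≤ C * r := by
          rw [hC, div_mul_cancel₀ _ hr.ne']
          exact Finset.single_le_sum (fun i _ => hc0 i) (Finset.mem_univ i)
        have := hc0 i
        linarith
      convert (hc i).add (IsSOS.algebraMap (P := P) hle) using 1
      rw [star_sub, star_algebraMap_real]
      rw [Complex.ofReal_add, Complex.ofReal_sub, map_add, map_sub]
      abel
    convert add_mem ((P.slackCone (i : Fin m)).smul_mem hC0 h1) h2 using 1
    change grad (P.g i) (C • q) - (0 + y i) = _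
    rw [zero_add, smul_sub, real_smul_eq C (algebraMap ℂ (NCPoly n) r),
      Algebra.algebraMap_eq_smul_one, Algebra.algebraMap_eq_smul_one, smul_smul,
      Complex.ofReal_mul, grad_smul_real]
    abel)
  have hG2 : ∀ y a, G (y, a) = G (y, 0) + a := by
    intro y a
    have h1 : G (0, a) = a := hGF ⟨(0, a), a, rfl⟩
    rw [← h1, ← map_add, h1]
    simp
  let ν : I → NCPoly n →ₗ[ℝ] ℝ := fun i =>
    -(G ∘ₗ LinearMap.inl ℝ _ ℝ ∘ₗ LinearMap.single ℝ (fun _ : I => NCPoly n) i)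
  have hν : ∀ i : I, ∀ y ∈ P.slackCone i, 0 ≤ ν i y := by
    intro i y hy
    -- The zero direction satisfies the constraints relaxed by `-y` for `y` in the slack cone, which
    -- explains the sign in `ν`.
    have h1 := hG (-(Pi.single i y), 0) ⟨0, zero_mem _, ?_, fun l => ?_⟩
    · have h2 : ((-(Pi.single i y) : I → NCPoly n), (0 : ℝ)) = -((Pi.single i y), 0) := by simp
      rw [h2, map_neg] at h1
      simpa [ν] using h1
    · have h0 : grad P.f 0 = 0 := map_zero (gradLin P.f)
      simp [h0]
    · have h0 : grad (P.g l) 0 = 0 := map_zero (gradLin _)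
      rw [h0]
      by_cases hl : l = i
      · subst hl; simpa using hy
      · simp [hl, zero_mem]
  refine ⟨fun i => complexExt (ν i), fun i => isPositiveFunctional_complexExt (hν i),
    fun t ht => ?_⟩
  have h1 := hG (fun i => grad (P.g i) t, (σ (grad P.f t)).re)
    ⟨t, ht, le_rfl, fun i => by simp [zero_mem]⟩
  rw [hG2] at h1
  have h2 : ∑ i, (complexExt (ν i) (grad (P.g i) t)).re = -G (fun i => grad (P.g i) t, 0) := by
    simp only [complexExt_re, ν, LinearMap.neg_apply, LinearMap.comp_apply,
      Finset.sum_neg_distrib, ← map_sum, LinearMap.inl_apply]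
    congr 2
    refine Prod.ext ?_ ?_
    · rw [Prod.fst_sum]
      exact Finset.univ_sum_single fun i : I => grad (P.g i) t
    · simp [Prod.snd_sum]
  rw [h2]
  linarith

end NPOProblem
end

/-! ### Truncated spaces and multiplier conditions. -/

noncomputable section

open NCPoly

namespace NCPoly

variable {n : ℕ}

/-- The words of length at most `d`. -/
abbrev Word (n d : ℕ) : Type := {w : FreeMonoid (Fin n) // w.length ≤ d}

instance (d : ℕ) : Fintype (Word n d) :=
  have : Finite (Word n d) := List.finite_length_le (Fin n) d
  Fintype.ofFinite _

/-- The polynomial with given coefficients. -/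
def ofCoeffs (d : ℕ) : (Word n d → ℂ) →ₗ[ℂ] NCPoly n where
  toFun a := ∑ w : Word n d, a w • MonoidAlgebra.single w.1 1
  map_add' a b := by simp only [Pi.add_apply, add_smul, Finset.sum_add_distrib]
  map_smul' c a := by
    simp only [Pi.smul_apply, smul_eq_mul, mul_smul, Finset.smul_sum, RingHom.id_apply]

theorem ofCoeffs_mem (d : ℕ) (a : Word n d → ℂ) : ofCoeffs d a ∈ degLE n d :=
  Submodule.sum_mem _ fun w _ => Submodule.smul_mem _ _ (single_mem_degLE 1 w.2)

theorem ofCoeffs_coeff {p : NCPoly n} {d : ℕ} (hp : deg p ≤ d) :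
    ofCoeffs d (fun w => p.coeff w.1) = p := by
  conv_rhs => rw [← sum_terms p]
  have h1 : ofCoeffs d (fun w => p.coeff w.1) = ∑ w ∈ Finset.univ.map (Function.Embedding.subtype
      fun w : FreeMonoid (Fin n) => w.length ≤ d), MonoidAlgebra.single w (p.coeff w) := by
    rw [Finset.sum_map]
    exact Finset.sum_congr rfl fun w _ => by simp [MonoidAlgebra.smul_single]
  rw [h1]
  symm
  refine Finset.sum_subset (fun w hw => ?_) fun w _ hw => ?_
  · simpa using (length_le_deg hw).trans hp
  · rw [Finsupp.notMem_support_iff.1 hw, MonoidAlgebra.single_zero]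

/-- Coefficient vectors carry the sup norm, so an error bound in that norm is at least as strong as
the one required in the `2`-norm. -/
theorem norm_coeffs_sq_le_normSq (p : NCPoly n) (d : ℕ) :
    ‖fun w : Word n d => p.coeff w.1‖ ^ 2 ≤ normSq p := by
  have h0 : 0 ≤ normSq p := Finset.sum_nonneg fun w _ => sq_nonneg _
  rw [← Real.le_sqrt (norm_nonneg _) h0]
  refine (pi_norm_le_iff_of_nonneg (Real.sqrt_nonneg _)).2 fun w => ?_
  rw [Real.le_sqrt (norm_nonneg _) h0]
  by_cases hw : p.coeff w.1 = 0
  · simpa [hw] using h0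
  · exact Finset.single_le_sum (f := fun w => ‖p.coeff w‖ ^ 2) (fun w _ => sq_nonneg _)
      (Finsupp.mem_support_iff.2 hw)

instance finite_degLE (d : ℕ) : Module.Finite ℂ (degLE n d) :=
  Module.Finite.of_surjective ((ofCoeffs d).codRestrict (degLE n d) (ofCoeffs_mem d))
    fun p => ⟨_, Subtype.ext (ofCoeffs_coeff p.2)⟩

instance finite_real_degLE (d : ℕ) : Module.Finite ℝ (degLE n d) := Module.Finite.trans ℂ _

/-- The sesquilinear map `(a, b) ↦ a G b^*` in terms of coefficients. -/
def sesqMap {G : NCPoly n} {d e : ℕ} (h : ∀ p ∈ degLE n d, ∀ p' ∈ degLE n d,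
    p * G * star p' ∈ degLE n e) : (Word n d → ℂ) →ₗ[ℝ] (Word n d → ℂ) →ₗ[ℝ] degLE n e :=
  LinearMap.mk₂ ℝ
    (fun a b => ⟨ofCoeffs d a * G * star (ofCoeffs d b), h _ (ofCoeffs_mem d a) _ (ofCoeffs_mem d b)⟩)
    (fun a a' b => Subtype.ext (by simp [add_mul]))
    (fun c a b => Subtype.ext (by
      have : ofCoeffs d (c • a) = c • ofCoeffs d a := (ofCoeffs d).map_smul_of_tower c a
      simp [this]))
    (fun a b b' => Subtype.ext (by simp [mul_add]))
    (fun c a b => Subtype.ext (by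
      have : ofCoeffs d (c • b) = c • ofCoeffs d b := (ofCoeffs d).map_smul_of_tower c b
      simp [this, star_smul]))

theorem tupleDeg_le_iff {t : Fin n → NCPoly n} {d : ℕ} :
    tupleDeg t ≤ d ↔ ∀ i, t i ∈ degLE n d := by
  simp [tupleDeg, Finset.sup_le_iff, mem_degLE]

theorem tupleDeg_add_le (t t' : Fin n → NCPoly n) :
    tupleDeg (t + t') ≤ max (tupleDeg t) (tupleDeg t') :=
  tupleDeg_le_iff.2 fun i => Submodule.add_mem _
    (degLE_mono (le_max_left _ _) (tupleDeg_le_iff.1 le_rfl i))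
    (degLE_mono (le_max_right _ _) (tupleDeg_le_iff.1 le_rfl i))

theorem tupleDeg_smul_le (c : ℂ) (t : Fin n → NCPoly n) : tupleDeg (c • t) ≤ tupleDeg t :=
  tupleDeg_le_iff.2 fun i => Submodule.smul_mem _ c (tupleDeg_le_iff.1 le_rfl i)

@[simp] theorem tupleDeg_zero : tupleDeg (0 : Fin n → NCPoly n) = 0 :=
  Nat.le_zero.1 (tupleDeg_le_iff.2 fun _ => Submodule.zero_mem _)

end NCPoly

namespace NPOProblem

variable {n m m' : ℕ} {P : NPOProblem n m m'}

theorem DegBound.mono {k : ℕ} {t t' : Fin n → NCPoly n} (h : P.DegBound k t)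
    (htt' : tupleDeg t' ≤ tupleDeg t) : P.DegBound k t' :=
  ⟨(Nat.add_le_add_left htt' _).trans h.f, fun i => (Nat.add_le_add_left htt' _).trans (h.g i),
    fun j => (Nat.add_le_add_left htt' _).trans (h.h j)⟩

/-- The space of `k`-admissible tuples. -/
def admissible {k : ℕ} (h0 : P.DegBound k 0) : Submodule ℂ (Fin n → NCPoly n) where
  carrier := {t | P.DegBound k t}
  zero_mem' := h0
  add_mem' {t t'} ht ht' := by
    rcases max_cases (tupleDeg t) (tupleDeg t') with h | h
    · exact DegBound.mono ht ((tupleDeg_add_le t t').trans h.1.le)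
    · exact DegBound.mono ht' ((tupleDeg_add_le t t').trans h.1.le)
  smul_mem' c t ht := DegBound.mono ht (tupleDeg_smul_le c t)

theorem zero_isIneqMultiplier (k : ℕ) {ε : ℝ} (hε : 0 ≤ ε) (i : Fin m) :
    P.IsIneqMultiplier k ε i 0 := by
  have h : ∀ p : NCPoly n, (0 : ℂ) ≤ 0 + ((ε * normSq p : ℝ) : ℂ) := fun p => by
    rw [zero_add]
    exact Complex.zero_le_real.2 (mul_nonneg hε (Finset.sum_nonneg fun w _ => sq_nonneg _))
  exact ⟨by simp, fun p _ => h p, fun _ p _ => h p, by simp, by simp, by simp⟩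

variable (P) in
/-- The product of the truncated cones of all constraints outside `I` and of all equalities. -/
def truncatedCone (I : Finset (Fin m)) (k : ℕ) :
    PointedCone ℝ (({i // i ∉ I} → degLE n (2 * k)) × (Fin m' → degLE n (2 * k))) where
  carrier := {x | (∀ i : {i // i ∉ I}, (x.1 i : NCPoly n) ∈ P.slackCone i) ∧
    ∀ j, (x.2 j : NCPoly n) ∈ P.hermIdeal}
  zero_mem' := ⟨fun i => zero_mem _, fun j => zero_mem _⟩
  add_mem' h h' := ⟨fun i => add_mem (h.1 i) (h'.1 i), fun j => add_mem (h.2 j) (h'.2 j)⟩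
  smul_mem' := by
    rintro ⟨c, hc⟩ x h
    exact ⟨fun i => (P.slackCone (i : Fin m)).smul_mem hc (h.1 i),
      fun j => P.hermIdeal.smul_mem c (h.2 j)⟩

theorem mem_truncatedCone {I : Finset (Fin m)} {k : ℕ}
    {x : ({i // i ∉ I} → degLE n (2 * k)) × (Fin m' → degLE n (2 * k))} :
    x ∈ P.truncatedCone I k ↔ (∀ i : {i // i ∉ I}, (x.1 i : NCPoly n) ∈ P.slackCone i) ∧
      ∀ j, (x.2 j : NCPoly n) ∈ P.hermIdeal := Iff.rfl

theorem complexExt_star_degLE {d : ℕ} {ν : degLE n d →ₗ[ℝ] ℝ}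
    (hν : ∀ y : degLE n d, (y : NCPoly n) + star (y : NCPoly n) = 0 → ν y = 0) (p : NCPoly n)
    (hp : p ∈ degLE n d) :
    complexExt ν ⟨star p, star_mem_degLE hp⟩ = star (complexExt ν ⟨p, hp⟩) := by
  refine complexExt_star (S := fun x : degLE n d => ⟨star x.1, star_mem_degLE x.2⟩)
    (fun x => ?_) (fun x => Subtype.ext (by simp [star_smul])) ⟨p, hp⟩
  have := hν (⟨star x.1, star_mem_degLE x.2⟩ - x) (by simp)
  rw [map_sub] at this
  linarith

theorem complexExt_add_nonneg {d : ℕ} {ν : degLE n d →ₗ[ℝ] ℝ}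
    (hν : ∀ y : degLE n d, (y : NCPoly n) + star (y : NCPoly n) = 0 → ν y = 0) {p : NCPoly n}
    (hp : p ∈ degLE n d) {c : ℝ} (hs : star p = p) (hc : 0 ≤ ν ⟨p, hp⟩ + c) :
    0 ≤ complexExt ν ⟨p, hp⟩ + (c : ℂ) := by
  refine Complex.nonneg_of_star_eq ?_ (by simpa using hc)
  have h1 : star (complexExt ν ⟨p, hp⟩) = complexExt ν ⟨p, hp⟩ := by
    rw [← complexExt_star_degLE hν]
    exact congrArg _ (Subtype.ext hs)
  rw [star_add, h1, Complex.star_def, Complex.conj_ofReal]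

/-- The range of a complex-linear `F` is stable under `-1` and `i`, so its elements and their
`i`-multiples lie in the lineality space. Only `F u` needs bounded degree. -/
theorem complexExt_eq_zero_of_forall {d : ℕ} {S : PointedCone ℝ (NCPoly n)}
    {ν : degLE n d →ₗ[ℝ] ℝ} (hν : ∀ y : degLE n d, (y : NCPoly n) ∈ S →
      -(y : NCPoly n) ∈ S → ν y = 0) {F : NCPoly n →ₗ[ℂ] NCPoly n} (hF : ∀ u, F u ∈ S)
    (u : NCPoly n) (hu : F u ∈ degLE n d) : complexExt ν ⟨F u, hu⟩ = 0 := by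
  refine complexExt_eq_zero (hν _ (hF u) ?_) (hν _ ?_ ?_)
  · rw [← map_neg]; exact hF _
  · have := hF (Complex.I • u)
    rw [map_smul] at this
    exact this
  · have := hF (-(Complex.I • u))
    rw [map_neg, map_smul] at this
    exact this

/-- The slack cone is not truncated by degrees of certificates, so every equality-type condition of
order `k` comes from its lineality space and holds exactly. The tolerance enters only the moment and
localizing conditions. -/
theorem isIneqMultiplier_complexExt {k : ℕ} {ε : ℝ} {i : Fin m}
    {ν : degLE n (2 * k) →ₗ[ℝ] ℝ}
    (hν : ∀ y : degLE n (2 * k), (y : NCPoly n) ∈ P.slackCone i →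
      -(y : NCPoly n) ∈ P.slackCone i → ν y = 0)
    (hmom : ∀ (p : NCPoly n) (hp : deg p ≤ k),
      0 ≤ ν ⟨p * star p, mul_star_mem hp⟩ + ε * normSq p)
    (hloc : ∀ (l : Fin m) (p : NCPoly n) (hp : deg p + (deg (P.g l) + 1) / 2 ≤ k),
      0 ≤ ν ⟨p * P.g l * star p, mul_mul_star_mem hp⟩ + ε * normSq p) :
    P.IsIneqMultiplier k ε i (complexExt ν) := by
  have hskew : ∀ y : degLE n (2 * k), (y : NCPoly n) + star (y : NCPoly n) = 0 → ν y = 0 :=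
    fun y hy => hν y (skew_mem_slackCone hy i) (skew_mem_slackCone (by
      rw [star_neg, ← neg_add, hy, neg_zero]) i)
  exact
    { hermitian := complexExt_star_degLE hskew
      moment := fun p hp => complexExt_add_nonneg hskew _ (by simp) (hmom p hp)
      localizing := fun l p hp => complexExt_add_nonneg hskew _
        (by simp [(P.g_symm l).star_eq, mul_assoc]) (hloc l p hp)
      eq_zero := fun j u v hd => complexExt_eq_zero_of_forall hν
        (F := LinearMap.mulRight ℂ v ∘ₗ LinearMap.mulRight ℂ (P.h j))
        (fun u => mul_eq_mul_mem_slackCone j u v i) u (mul_mul_mem hd)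
      slack_left := fun s hs => complexExt_eq_zero_of_forall hν (F := LinearMap.mulRight ℂ (P.g i))
        (mul_ineq_mem_slackCone i) s (mul_mem hs)
      slack_right := fun s hs => complexExt_eq_zero_of_forall hν (F := LinearMap.mulLeft ℂ (P.g i))
        (ineq_mul_mem_slackCone i) s (mul_mem hs) }

theorem isEqMultiplier_complexExt {k : ℕ} {ν : degLE n (2 * k) →ₗ[ℝ] ℝ}
    (hν : ∀ y : degLE n (2 * k), (y : NCPoly n) ∈ P.hermIdeal → ν y = 0) :
    P.IsEqMultiplier k (complexExt ν) := by
  refine ⟨complexExt_star_degLE fun y hy => hν y ?_, fun j u v hd => ?_⟩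
  · rw [mem_hermIdeal, hy]
    exact P.idealJ.zero_mem
  · exact complexExt_eq_zero_of_forall (S := PointedCone.ofSubmodule P.hermIdeal)
      (fun y hy _ => hν y hy)
      (F := LinearMap.mulRight ℂ v ∘ₗ LinearMap.mulRight ℂ (P.h j))
      (fun u => mem_hermIdeal_of_mem (mul_eq_mul_mem_idealJ j u v)) u (mul_mul_mem hd)

end NPOProblem
end

/-! ### Approximate multipliers and the theorem. -/

noncomputable section

open NCPoly

theorem LinearMap.apply_prod_pi_eq_sum {ι κ E : Type*} [Fintype ι] [Fintype κ] [DecidableEq ι]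
    [DecidableEq κ] [AddCommGroup E] [Module ℝ E] (ν : ((ι → E) × (κ → E)) →ₗ[ℝ] ℝ)
    (y : ι → E) (z : κ → E) :
    ν (y, z) = ∑ i, ν (Pi.single i (y i), 0) + ∑ j, ν (0, Pi.single j (z j)) := by
  rw [← map_sum, ← map_sum, ← map_add]
  congr 1
  refine Prod.ext ?_ ?_
  · simp [Prod.fst_sum, Finset.univ_sum_single]
  · simp [Prod.snd_sum, Finset.univ_sum_single]

theorem Fintype.sum_eq_sum_mem_add_sum_notMem {ι M : Type*} [Fintype ι] [DecidableEq ι]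
    [AddCommMonoid M] (I : Finset ι) {F : ι → M} {a : I → M} {b : {i // i ∉ I} → M}
    (ha : ∀ i : I, F i = a i) (hb : ∀ i : {i // i ∉ I}, F i = b i) :
    ∑ i, F i = ∑ i, a i + ∑ i, b i := by
  have h : ∑ i ∈ Iᶜ, F i = ∑ i : {i // i ∉ I}, F i :=
    Finset.sum_subtype _ (fun i => Finset.mem_compl) F
  rw [← Finset.sum_add_sum_compl I F, ← Finset.sum_coe_sort I F, h]
  simp only [ha, hb]

namespace NPOProblem

variable {n m m' : ℕ} {P : NPOProblem n m m'}

variable (P) in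
/-- The indices of the localizing constraints that are visible at order `k`, and `none` for the
moment constraint. -/
abbrev LocalizerIndex (k : ℕ) : Type := Option {l : Fin m // (deg (P.g l) + 1) / 2 ≤ k}

/-- The polynomial `G` in the localizing constraint `μ(p G p^*) ≥ 0`. -/
def localizer {k : ℕ} (o : P.LocalizerIndex k) : NCPoly n := o.elim 1 fun l => P.g l

/-- The largest degree of `p` in the localizing constraint `μ(p G p^*) ≥ 0` of order `k`. -/
def localizerDeg {k : ℕ} (o : P.LocalizerIndex k) : ℕ :=
  o.elim k fun l => k - (deg (P.g l) + 1) / 2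

theorem localizer_mem {k : ℕ} (o : P.LocalizerIndex k) (p : NCPoly n)
    (hp : p ∈ degLE n (localizerDeg o)) (p' : NCPoly n) (hp' : p' ∈ degLE n (localizerDeg o)) :
    p * localizer o * star p' ∈ degLE n (2 * k) := by
  cases o with
  | none =>
    have h := mul_mem_degLE hp (star_mem_degLE hp')
    rw [← mul_one p] at h
    exact degLE_mono (two_mul k).ge h
  | some l =>
    refine degLE_mono ?_ (mul_mem_degLE (mul_mem_degLE hp (mem_degLE_self (P.g l)))
      (star_mem_degLE hp'))
    -- Visibility at order `k` keeps the natural-number subtraction in `localizerDeg` from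
    -- truncating.
    have := l.2
    change k - (deg (P.g l) + 1) / 2 + deg (P.g l) + (k - (deg (P.g l) + 1) / 2) ≤ 2 * k
    omega

theorem isSOS_localizer {k : ℕ} (o : P.LocalizerIndex k) (p : NCPoly n) :
    P.IsSOS (p * localizer o * star p) := by
  cases o with
  | none => simpa [localizer] using IsSOS.mul_star_self p
  | some l => exact IsSOS.mul_ineq_star _ p

theorem single_mem_truncatedCone {I : Finset (Fin m)} {k : ℕ} [DecidableEq {i // i ∉ I}]
    {i : {i // i ∉ I}}
    {y : degLE n (2 * k)} (hy : (y : NCPoly n) ∈ P.slackCone i) :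
    (Pi.single i y, 0) ∈ P.truncatedCone I k := by
  refine mem_truncatedCone.2 ⟨fun l => ?_, fun j => zero_mem _⟩
  by_cases hl : l = i
  · subst hl; simpa using hy
  · simp [hl, zero_mem]

/-- The linearization of the constraints outside `I` and of the equality constraints at order
`k`. -/
def truncatedGrad (I : Finset (Fin m)) {k : ℕ} (h0 : P.DegBound k 0) :
    admissible h0 →ₗ[ℝ] ({i // i ∉ I} → degLE n (2 * k)) × (Fin m' → degLE n (2 * k)) where
  toFun t := (fun i => ⟨grad (P.g i) t, grad_mem (t.2.g i)⟩,
    fun j => ⟨grad (P.h j) t, grad_mem (t.2.h j)⟩)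
  map_add' _ _ := Prod.ext (funext fun _ => Subtype.ext (grad_add _ _ _))
    (funext fun _ => Subtype.ext (grad_add _ _ _))
  map_smul' _ _ := Prod.ext (funext fun _ => Subtype.ext (grad_smul_real _ _ _))
    (funext fun _ => Subtype.ext (grad_smul_real _ _ _))

/-- Approximate multipliers at order `k`. -/
theorem exists_truncated_multipliers {I : Finset (Fin m)} {L : (Fin n → NCPoly n) →ₗ[ℂ] ℂ}
    (hL : ∀ t ∈ P.directionCone I, 0 ≤ (L t).re) (k : ℕ) {ε : {i // i ∉ I} → ℝ}
    (hε : ∀ i, 0 < ε i) :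
    ∃ (μk : {i // i ∉ I} → degLE n (2 * k) →ₗ[ℂ] ℂ) (lam : Fin m' → degLE n (2 * k) →ₗ[ℂ] ℂ),
      (∀ i, P.IsIneqMultiplier k (ε i) i (μk i)) ∧ (∀ j, P.IsEqMultiplier k (lam j)) ∧
      ∀ (t : Fin n → NCPoly n) (ht : P.DegBound k t),
        ∑ i, μk i ⟨grad (P.g i) t, grad_mem (ht.g i)⟩
          + ∑ j, lam j ⟨grad (P.h j) t, grad_mem (ht.h j)⟩ = L t := by
  classical
  -- If the zero tuple is not admissible then no tuple is, and zero multipliers suffice.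
  by_cases h0 : P.DegBound k 0
  swap
  · exact ⟨0, 0, fun i => zero_isIneqMultiplier k (hε i).le (i : Fin m), fun j => ⟨by simp, by simp⟩,
      fun t ht => absurd (ht.mono (by simp)) h0⟩
  let E := ({i // i ∉ I} → degLE n (2 * k)) × (Fin m' → degLE n (2 * k))
  let ins : {i // i ∉ I} → degLE n (2 * k) →ₗ[ℝ] E := fun i =>
    LinearMap.inl ℝ _ _ ∘ₗ LinearMap.single ℝ (fun _ => degLE n (2 * k)) i
  -- The factor `(ε i)⁻¹` turns the unit error of the separation lemma into tolerance `ε i`.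
  let B : ∀ x : {i // i ∉ I} × P.LocalizerIndex k, (Word n (localizerDeg x.2) → ℂ) →ₗ[ℝ]
      (Word n (localizerDeg x.2) → ℂ) →ₗ[ℝ] E := fun x =>
    (sesqMap (localizer_mem x.2)).compr₂ ((ε x.1)⁻¹ • ins x.1)
  have hB : ∀ x v, B x v v ∈ P.truncatedCone I k := fun x v =>
    (P.truncatedCone I k).smul_mem (inv_nonneg.2 (hε x.1).le)
      (single_mem_truncatedCone ((isSOS_localizer x.2 _).mem_slackCone _))
  obtain ⟨ν, hνA, hν0, hνB⟩ := exists_dual_nonneg_add_norm_sq B (P.truncatedCone I k) hB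
    (truncatedGrad I h0) (Complex.reLm ∘ₗ L.restrictScalars ℝ ∘ₗ
      (admissible h0).subtype.restrictScalars ℝ) (fun t ht => hL t
        ⟨fun i hi => ht.1 ⟨i, hi⟩, fun j => ht.2 j⟩)
  let ν₁ : {i // i ∉ I} → degLE n (2 * k) →ₗ[ℝ] ℝ := fun i => ν ∘ₗ ins i
  let ν₂ : Fin m' → degLE n (2 * k) →ₗ[ℝ] ℝ := fun j =>
    ν ∘ₗ LinearMap.inr ℝ _ _ ∘ₗ LinearMap.single ℝ (fun _ => degLE n (2 * k)) j
  have hloc : ∀ (i : {i // i ∉ I}) (o : P.LocalizerIndex k) (p : NCPoly n)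
      (hp : deg p ≤ localizerDeg o),
      0 ≤ ν₁ i ⟨p * localizer o * star p, localizer_mem o p hp p hp⟩ + ε i * normSq p := by
    intro i o p hp
    have h1 := hνB (i, o) fun w => p.coeff w.1
    have h2 : B (i, o) (fun w => p.coeff w.1) (fun w => p.coeff w.1) =
        (ε i)⁻¹ • ins i ⟨p * localizer o * star p, localizer_mem o p hp p hp⟩ := by
      have h3 : sesqMap (localizer_mem o) (fun w => p.coeff w.1) (fun w => p.coeff w.1) =
          ⟨p * localizer o * star p, localizer_mem o p hp p hp⟩ := by
        refine Subtype.ext ?_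
        change ofCoeffs _ _ * localizer o * star (ofCoeffs _ _) = _
        rw [ofCoeffs_coeff hp]
      rw [← h3]
      rfl
    rw [h2, map_smul, smul_eq_mul] at h1
    have h4 := h1.trans (add_le_add_right (norm_coeffs_sq_le_normSq p (localizerDeg o)) _)
    have h5 := mul_nonneg (hε i).le h4
    rw [mul_add, ← mul_assoc, mul_inv_cancel₀ (hε i).ne', one_mul] at h5
    exact h5
  refine ⟨fun i => complexExt (ν₁ i), fun j => complexExt (ν₂ j), fun i => ?_, fun j => ?_, ?_⟩
  · refine isIneqMultiplier_complexExt (fun y hy hy' => ?_) (fun p hp => ?_) fun l p hp => ?_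
    · refine hν0 _ (single_mem_truncatedCone hy) ?_
      have := single_mem_truncatedCone (P := P) (i := i) (y := -y) hy'
      rw [← map_neg]
      exact this
    · have := hloc i none p hp
      convert this using 4
      simp [localizer]
    · exact hloc i (some ⟨l, by omega⟩) p (by
        change _ ≤ k - (deg (P.g l) + 1) / 2
        omega)
  · refine isEqMultiplier_complexExt fun y hy => ?_
    have hmem : ∀ y : degLE n (2 * k), (y : NCPoly n) ∈ P.hermIdeal →
        ((0 : {i // i ∉ I} → degLE n (2 * k)), (Pi.single j y : Fin m' → degLE n (2 * k))) ∈
          P.truncatedCone I k := by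
      intro y hy
      refine mem_truncatedCone.2 ⟨fun i => zero_mem _, fun l => ?_⟩
      by_cases hl : l = j
      · subst hl; simpa using hy
      · simp [hl, zero_mem]
    refine hν0 _ (hmem y hy) ?_
    have := hmem (-y) (P.hermIdeal.neg_mem hy)
    rw [← map_neg]
    exact this
  · intro t ht
    -- Separation gives the identity only for real parts. Both sides are complex linear in `t` on
    -- the complex space of admissible tuples, so full equality follows.
    let M : admissible h0 →ₗ[ℂ] ℂ :=
      { toFun := fun t => ∑ i : {i // i ∉ I}, complexExt (ν₁ i) ⟨grad (P.g i) t, grad_mem (t.2.g i)⟩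
          + ∑ j, complexExt (ν₂ j) ⟨grad (P.h j) t, grad_mem (t.2.h j)⟩
        map_add' := fun t t' => by
          rw [add_add_add_comm, ← Finset.sum_add_distrib, ← Finset.sum_add_distrib]
          congr 1 <;> refine Finset.sum_congr rfl fun i _ => ?_ <;> rw [← map_add] <;>
            exact congrArg _ (Subtype.ext (grad_add _ _ _))
        map_smul' := fun c t => by
          rw [smul_add, Finset.smul_sum, Finset.smul_sum]
          congr 1 <;> refine Finset.sum_congr rfl fun i _ => ?_ <;>
            rw [RingHom.id_apply, ← map_smul] <;>
            exact congrArg _ (Subtype.ext (grad_smul _ _ _)) }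
    refine LinearMap.eq_of_re_eq (μ := M) (μ' := L ∘ₗ (admissible h0).subtype) (fun t => ?_) ⟨t, ht⟩
    have h1 := hνA t
    change _ = (L t).re at h1
    refine Eq.trans ?_ h1
    change (∑ i : {i // i ∉ I}, complexExt (ν₁ i) ⟨grad (P.g i) t, grad_mem (t.2.g i)⟩
          + ∑ j, complexExt (ν₂ j) ⟨grad (P.h j) t, grad_mem (t.2.h j)⟩).re = ν (_, _)
    rw [LinearMap.apply_prod_pi_eq_sum, Complex.add_re, Complex.re_sum, Complex.re_sum]
    simp only [complexExt_re]
    rfl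

/-- A positive functional restricts to an exact multiplier. -/
theorem isIneqMultiplier_domRestrict {i : Fin m} {μ : NCPoly n →ₗ[ℂ] ℂ}
    (hμ : IsPositiveFunctional μ) (hg : ∀ l, CompatibleIneq μ (P.g l))
    (hh : ∀ j, CompatibleEq μ (P.h j)) (hs : ∀ p, μ (p * P.g i) = 0 ∧ μ (P.g i * p) = 0)
    (k : ℕ) : P.IsIneqMultiplier k 0 i (μ.domRestrict (degLE n (2 * k))) where
  hermitian p _ := hμ.hermitian p
  moment p _ := by simpa using hμ.nonneg p
  localizing l p _ := by simpa using hg l p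
  eq_zero j u v _ := hh j u v
  slack_left s _ := (hs s).1
  slack_right s _ := (hs s).2

end NPOProblem

theorem mainTheorem2 {n m m' : ℕ} (P : NPOProblem n m m') (hArch : P.IsArchimedean)
    (I : Finset (Fin m)) (r : ℝ) (hr : 0 < r)
    (q : Fin n → NCPoly n) (hq : ∀ a, IsSelfAdjoint (q a)) (s : Fin m → NCPoly n)
    (hI : ∀ i ∈ I, P.IsSOS (NCPoly.grad (P.g i) q + s i * P.g i + P.g i * star (s i)
      - algebraMap ℂ (NCPoly n) r))
    (hIc : ∀ i ∉ I, P.IsSOS (NCPoly.grad (P.g i) q + s i * P.g i + P.g i * star (s i)))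
    (hJ : ∀ j, NCPoly.grad (P.h j) q ∈ P.idealJ)
    (σ : NCPoly n →ₗ[ℂ] ℂ) (hσ : P.IsMinimizer σ) :
    (∃ μ : I → NCPoly n →ₗ[ℂ] ℂ,
      (∀ i, NCPoly.IsPositiveFunctional (μ i)
        ∧ (∀ l, NCPoly.CompatibleIneq (μ i) (P.g l))
        ∧ (∀ j, NCPoly.CompatibleEq (μ i) (P.h j))
        ∧ ∀ p, μ i (p * P.g i) = 0 ∧ μ i (P.g i * p) = 0) ∧
      ∀ (k : ℕ) (ε : {i // i ∉ I} → ℝ), (∀ i, 0 < ε i) →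
        ∃ (μk : {i // i ∉ I} → NCPoly.degLE n (2 * k) →ₗ[ℂ] ℂ)
          (lam : Fin m' → NCPoly.degLE n (2 * k) →ₗ[ℂ] ℂ),
          (∀ i, P.IsIneqMultiplier k (ε i) i (μk i)) ∧
          (∀ j, P.IsEqMultiplier k (lam j)) ∧
          ∀ (t : Fin n → NCPoly n) (ht : P.DegBound k t),
            ∑ i, μk i ⟨NCPoly.grad (P.g i) t, NCPoly.grad_mem (ht.g i)⟩
              + ∑ j, lam j ⟨NCPoly.grad (P.h j) t, NCPoly.grad_mem (ht.h j)⟩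
            = σ (NCPoly.grad P.f t) - ∑ i, μ i (NCPoly.grad (P.g i) t)) ∧
    ∀ (k : ℕ) (ε : Fin m → ℝ), (∀ i ∈ I, ε i = 0) → (∀ i ∉ I, 0 < ε i) →
      P.EssentialKKT σ k ε := by
  obtain ⟨μ, hμ, hμL⟩ := hσ.exists_positive_multipliers hArch hr hq hI hIc hJ
  have key : ∀ (k : ℕ) (ε : {i // i ∉ I} → ℝ), (∀ i, 0 < ε i) → _ := fun k ε hε =>
    NPOProblem.exists_truncated_multipliers (P := P) (I := I)
      (L := σ ∘ₗ gradLin P.f - ∑ i, μ i ∘ₗ gradLin (P.g i)) (fun t ht => by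
        simpa using hμL t ht) k hε
  simp only [LinearMap.sub_apply, LinearMap.sum_apply, LinearMap.comp_apply,
    gradLin_apply] at key
  refine ⟨⟨μ, hμ, key⟩, fun k ε hε0 hε => ?_⟩
  obtain ⟨μk, lam, hμk, hlam, h⟩ := key k (fun i => ε i) fun i => hε i i.2
  -- On `I` the exact functionals are restricted to degree `2k`, which is why tolerance `0` is
  -- available there.
  refine ⟨fun i => if hi : i ∈ I then (μ ⟨i, hi⟩).domRestrict _ else μk ⟨i, hi⟩, lam,
    fun i => ?_, hlam, fun t ht => ?_⟩
  · by_cases hi : i ∈ I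
    · obtain ⟨h1, h2, h3, h4⟩ := hμ ⟨i, hi⟩
      simp only [hi, dif_pos, hε0 i hi]
      exact NPOProblem.isIneqMultiplier_domRestrict h1 h2 h3 h4 k
    · simp only [hi, dif_neg, not_false_eq_true]
      exact hμk ⟨i, hi⟩
  · rw [Fintype.sum_eq_sum_mem_add_sum_notMem I (a := fun i => μ i (grad (P.g i) t))
      (b := fun i => μk i ⟨grad (P.g i) t, grad_mem (ht.g i)⟩)
      (fun i => by beta_reduce; rw [dif_pos i.2]; rfl) (fun i => by beta_reduce; rw [dif_neg i.2])]
    linear_combination -h t ht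

end
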